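/- Let $W=\mathcal S_n$ be the symmetric group on $\{1,\dots,n\}$ with simple reflections $S=\{s_1,\dots,s_{n-1}\}$, $s_i=(i\;\,i+1)$, and length function $\ell$. For $I\subset S$ let $W_I$ be the parabolic subgroup generated by $I$, $w_I$ its longest element, and $\ell(I)=\ell(w_I)$. An $(I,J)$-coset is an element $p$ of $W_I\backslash W/W_J$; $\underline p$ and $\overline p$ denote its minimal and maximal elements in the Bruhat order. It is a *core coset* if $I=I\cap\underline pJ\underline p^{-1}$ and $J=\underline p^{-1}I\underline p\cap J$. An $(I,J)$-expression is a sequence $[[I=I_0\subset K_1\supset I_1\subset\dots\subset K_d\supset I_d=J]]$ of subsets of $S$ ($d\ge 0$); it is a *reduced expression* of the $(I,J)$-coset $p$ if $\overline p=w_{K_1}w_{I_1}^{-1}w_{K_2}\cdots w_{K_d}$ and $\ell(\overline p)=\ell(K_1)-\ell(I_1)+\ell(K_2)-\dots+\ell(K_d)$ (read as $\overline p = w_I$, $\ell(\overline p)=\ell(I)$ when $d=0$). A core $(I,J)$-coset is *atomic* if $J=(I\cup\{s\})\setminus\{t\}$ for some $s\in S\setminus I$, $t\in I\cup\{s\}$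 and $[[I\subset I\cup\{s\}\supset J]]$ is a reduced expression of it. An *atomic reduced expression* of $p$ is a reduced expression of $p$ each of whose steps $[[I_{i-1}\subset K_i\supset I_i]]$ is a reduced expression of an atomic $(I_{i-1},I_i)$-coset $p_i$. For $p\in W_I\backslash W/W_J$ and $q\in W_J\backslash W/W_K$ write $r=p.q$ if $\overline p*\overline q=(\overline pw_J^{-1})\overline q=\overline p(w_J^{-1}\overline q)$, where $*$ is the product of the Coxeter monoid ($0$-Hecke monoid) of $W$, if the lengths add in both of these products of group elements, and if $r=W_I(\overline p*\overline q)W_K$. In a Coxeter group, $x.y$ denotes the product $xy$ under the condition $\ell(xy)=\ell(x)+\ell(y)$. For $J\subset S$ let $\sim_J$ be the equivalence relation on $\{1,\dots,n\}$ generated by $j\sim_J j+1$ for $s_j\in J$. If $\#J=m$, it has $n-m$ classes, the *components* of $J$, which are intervals; they are numbered $1,\dots,n-m$ from left to right. Fix $m$. Then: 1. If $p$ is a core $(I,J)$-coset with $\#J=m$, then $\#I=m$, and $\underline p$ maps each component of $J$ onto a component of $I$ by an order-preserving bijection. So there is exactly one permutation $\mathbb Sq(p)\in\mathcal S_{n-m}$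 (the *squashed permutation*) such that $\underline p$ maps the component of $J$ with number $c$ onto the component of $I$ with number $\mathbb Sq(p)(c)$. 2. If $p$ is a core $(I,J)$-coset with $\#J=m$, then sending an atomic reduced expression with steps expressing $p_1,\dots,p_d$ to $(\mathbb Sq(p_1),\dots,\mathbb Sq(p_d))$ is a bijection $$\{\text{atomic reduced expressions of }p\}\longrightarrow\{\text{ordinary reduced expressions of }\mathbb Sq(p)\text{ in }\mathcal S_{n-m}\}.$$ 3. If $p$ is an atomic $(I,J)$-coset with $\#J=m$, then $\mathbb Sq(p)$ is a simple reflection of $\mathcal S_{n-m}$. For every fixed $J\subset S$ with $\#J=m$, the map $(I,p)\mapsto\mathbb Sq(p)$ is a bijection from the set of pairs $(I,p)$ with $p$ an atomic $(I,J)$-coset to the set of simple reflections of $\mathcal S_{n-m}$. 4. If $p$ is a core $(I,J)$-coset, $q$ a core $(J,K)$-coset, $\#J=m$, and $r=p.q$, then $r$ is a core $(I,K)$-coset and $\mathbb Sq(r)=\mathbb Sq(p).\mathbb Sq(q)$, that is, $\mathbb Sq(r)=\mathbb Sq(p)\mathbb Sq(q)$ and $\ell(\mathbb Sq(r))=\ell(\mathbb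 Sq(p))+\ell(\mathbb Sq(q))$. -/

import Mathlib

/-! Double cosets, core cosets, atomic cosets and their reduced expressions in a Coxeter group
`W` with set of simple reflections `S`, and squashing in the symmetric groups.
The first part is written for a group `W` with a set `S` of generators. It is applied only to
finite Coxeter groups, where every subset of `S` is finitary. -/

namespace CoreCoset

noncomputable section

section Coxeter

variable {W : Type*} [Group W]

/-- The Coxeter length: the least number of factors in an expression of `w` as a product of
simple reflections. -/
def len (S : Set W) (w : W) : ℕ :=
  sInf {k | ∃ l : List W, (∀ x ∈ l, x ∈ S) ∧ l.prod = w ∧ l.length = k}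

/-- `l` is an (ordinary) reduced expression of `w`. -/
def IsRex (S : Set W) (w : W) (l : List W) : Prop :=
  (∀ x ∈ l, x ∈ S) ∧ l.prod = w ∧ l.length = len S w

/-- The product `x y` is a reduced composition, `x y = x . y`. -/
def LenAdd (S : Set W) (x y : W) : Prop :=
  len S (x * y) = len S x + len S y

/-- The Bruhat order, generated by `x < x t` for reflections `t` (conjugates of simple
reflections) with `ℓ(x) < ℓ(x t)`. -/
def BruhatLE (S : Set W) : W → W → Prop :=
  Relation.ReflTransGen fun x y =>
    ∃ g : W, ∃ s ∈ S, y = x * (g * s * g⁻¹) ∧ len S x < len S y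

open Classical in
/-- The Bruhat-smallest element of `p` (with value `1` if there is none). -/
def minElt (S : Set W) (p : Set W) : W :=
  if h : ∃ x ∈ p, ∀ y ∈ p, BruhatLE S x y then h.choose else 1

open Classical in
/-- The Bruhat-largest element of `p` (with value `1` if there is none). -/
def maxElt (S : Set W) (p : Set W) : W :=
  if h : ∃ x ∈ p, ∀ y ∈ p, BruhatLE S y x then h.choose else 1

/-- The longest element `w_I` of the parabolic subgroup `W_I`. -/
def longest (S I : Set W) : W :=
  maxElt S (Subgroup.closure I : Set W)

/-- The double coset `W_I w W_J`. -/
def dcoset (I J : Set W) (w : W) : Set W :=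
  DoubleCoset.doubleCoset w (Subgroup.closure I : Set W) (Subgroup.closure J : Set W)

/-- `p` is an `(I,J)`-coset. -/
def IsDCoset (S I J : Set W) (p : Set W) : Prop :=
  I ⊆ S ∧ J ⊆ S ∧ ∃ w : W, p = dcoset I J w

/-- The left redundancy `I ∩ x J x⁻¹`, where `x` is the minimal element of `p`. -/
def leftRed (S I J : Set W) (p : Set W) : Set W :=
  I ∩ (fun j => minElt S p * j * (minElt S p)⁻¹) '' J

/-- The right redundancy `x⁻¹ I x ∩ J`, where `x` is the minimal element of `p`. -/
def rightRed (S I J : Set W) (p : Set W) : Set W :=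
  (fun i => (minElt S p)⁻¹ * i * minElt S p) '' I ∩ J

/-- `p` is a core `(I,J)`-coset. -/
def IsCore (S I J : Set W) (p : Set W) : Prop :=
  IsDCoset S I J p ∧ leftRed S I J p = I ∧ rightRed S I J p = J

open Classical in
/-- The product `x * y` in the Coxeter monoid, where `W` is identified with the Coxeter monoid
through reduced expressions: the letters of a reduced expression of `y` are multiplied to `x`
one after the other, and `x * s` is `x s` if this is longer than `x`, and `x` otherwise.
(The result does not depend on the reduced expression.) -/
def star (S : Set W) (x y : W) : W :=
  if h : ∃ l : List W, IsRex S y l then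
    h.choose.foldl (fun z s => if len S z < len S (z * s) then z * s else z) x
  else x * y

/-- For an `(I,J)`-coset `p` and a `(J,K)`-coset `q`, the composition `p * q` is reduced. -/
def IsReducedComp (S J : Set W) (p q : Set W) : Prop :=
  LenAdd S (maxElt S p * (longest S J)⁻¹) (maxElt S q) ∧
  LenAdd S (maxElt S p) ((longest S J)⁻¹ * maxElt S q) ∧
  star S (maxElt S p) (maxElt S q) = maxElt S p * (longest S J)⁻¹ * maxElt S q

/-- `r = p . q`, that is `r = p * q = W_I (p̄ * q̄) W_K` and this composition is reduced,
for an `(I,J)`-coset `p` and a `(J,K)`-coset `q`. -/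
def IsReducedProd (S I J K : Set W) (r p q : Set W) : Prop :=
  IsReducedComp S J p q ∧ r = dcoset I K (star S (maxElt S p) (maxElt S q))

/-- A multistep expression `[[I = I₀ ⊆ K₁ ⊇ I₁ ⊆ K₂ ⊇ … ⊆ K_d ⊇ I_d = J]]` is given by `I` and
the list `[(K₁, I₁), …, (K_d, I_d)]`. Concatenation of expressions is concatenation of lists. -/
def IsExpr (S : Set W) : Set W → Set W → List (Set W × Set W) → Prop
  | I, J, [] => I ⊆ S ∧ I = J
  | I, J, (K, I') :: l => I ⊆ K ∧ I' ⊆ K ∧ K ⊆ S ∧ IsExpr S I' J l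

/-- The element `w_{K₁} w_{I₁}⁻¹ w_{K₂} w_{I₂}⁻¹ ⋯ w_{K_d}` of a multistep expression
(`w_I` if `d = 0`). The recursion produces a last factor `w_{I_d}⁻¹ w_{I_d} = 1`. -/
def exprElt (S : Set W) : Set W → List (Set W × Set W) → W
  | I, [] => longest S I
  | _, (K, I') :: l => longest S K * (longest S I')⁻¹ * exprElt S I' l

/-- The integer `ℓ(K₁) - ℓ(I₁) + ℓ(K₂) - ⋯ + ℓ(K_d)` of a multistep expression
(`ℓ(I)` if `d = 0`). -/
def exprLen (S : Set W) : Set W → List (Set W × Set W) → ℤ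
  | I, [] => len S (longest S I)
  | _, (K, I') :: l =>
      (len S (longest S K) : ℤ) - len S (longest S I') + exprLen S I' l

/-- The multistep expression given by `I` and `l` is a reduced expression of the
`(I,J)`-coset `p`. -/
def IsReducedExpr (S I J : Set W) (p : Set W) (l : List (Set W × Set W)) : Prop :=
  IsDCoset S I J p ∧ IsExpr S I J l ∧
    maxElt S p = exprElt S I l ∧ (len S (maxElt S p) : ℤ) = exprLen S I l

/-- `p` is an atomic `(I,J)`-coset: a core coset with a reduced expression
`[I + s - t] = [I, I ∪ {s}, (I ∪ {s}) \ {t}]`. -/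
def IsAtomic (S I J : Set W) (p : Set W) : Prop :=
  IsCore S I J p ∧ ∃ s ∈ S, ∃ t ∈ S, s ∉ I ∧ t ∈ I ∪ {s} ∧ J = (I ∪ {s}) \ {t} ∧
    IsReducedExpr S I J p [(I ∪ {s}, J)]

/-- Every step `[[I_{i-1} ⊆ K_i ⊇ I_i]]` is a reduced expression of an atomic coset. -/
def AtomicSteps (S : Set W) : Set W → List (Set W × Set W) → Prop
  | _, [] => True
  | I, (K, I') :: l =>
      (∃ q, IsAtomic S I I' q ∧ IsReducedExpr S I I' q [(K, I')]) ∧ AtomicSteps S I' l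

/-- Atomic reduced expressions of the `(I,J)`-coset `p`: reduced expressions which are
compositions of reduced expressions of atomic cosets. -/
def IsAtomicRex (S I J : Set W) (p : Set W) (l : List (Set W × Set W)) : Prop :=
  IsReducedExpr S I J p l ∧ AtomicSteps S I l

end Coxeter

section TypeA

/-- The simple reflections of the symmetric group on `{0, …, n-1}`: the transpositions of
neighbours. -/
def simples (n : ℕ) : Set (Equiv.Perm (Fin n)) :=
  {w | ∃ i j : Fin n, (j : ℕ) = i + 1 ∧ w = Equiv.swap i j}

variable {n : ℕ}

/-- The equivalence class of `x` for the equivalence relation generated by `j ∼ j + 1` whenever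
the transposition of `j` and `j + 1` lies in `J`. -/
def component (J : Set (Equiv.Perm (Fin n))) (x : Fin n) : Set (Fin n) :=
  {z | Relation.EqvGen (fun i j : Fin n => (j : ℕ) = i + 1 ∧ Equiv.swap i j ∈ J) x z}

/-- The position (counted from `0`) of the component of `x` in the ordered set of components:
the number of components which lie to the left of it. -/
def compIndex (J : Set (Equiv.Perm (Fin n))) (x : Fin n) : ℕ :=
  Set.ncard {C : Set (Fin n) | (∃ z, C = component J z) ∧
    ∀ a ∈ C, ∀ b ∈ component J x, a < b}

/-- `y` maps each component for `J` by an order-preserving bijection onto a component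
for `I`. -/
def IsBlockPerm (I J : Set (Equiv.Perm (Fin n))) (y : Equiv.Perm (Fin n)) : Prop :=
  ∀ x : Fin n, y '' component J x = component I (y x) ∧ StrictMonoOn y (component J x)

/-- `w` is the permutation of the `n - m` positions of components which is induced by the
block permutation `y`. -/
def IsSquash (m : ℕ) (I J : Set (Equiv.Perm (Fin n))) (y : Equiv.Perm (Fin n))
    (w : Equiv.Perm (Fin (n - m))) : Prop :=
  ∀ x : Fin n, ∃ c : Fin (n - m), (c : ℕ) = compIndex J x ∧ (w c : ℕ) = compIndex I (y x)

open Classical in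
/-- The squashed permutation of a block permutation `y` relative to sets `I` and `J` of size `m`
(with value `1` if `y` does not induce a permutation). -/
def squash (m : ℕ) (I J : Set (Equiv.Perm (Fin n))) (y : Equiv.Perm (Fin n)) :
    Equiv.Perm (Fin (n - m)) :=
  if h : ∃ w, IsSquash m I J y w then h.choose else 1

/-- The squashed permutation `𝕊q(p)` of a core `(I,J)`-coset `p`, where `I` and `J` have
size `m`. -/
def Sq (m : ℕ) (I J : Set (Equiv.Perm (Fin n))) (p : Set (Equiv.Perm (Fin n))) :
    Equiv.Perm (Fin (n - m)) :=
  squash m I J (minElt (simples n) p)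

/-- The list `(𝕊q(p₁), …, 𝕊q(p_d))`, where `p_i` is the coset of `w_{K_i}` with the expression
`[[I_{i-1} ⊆ K_i ⊇ I_i]]`. -/
def sqExpr (m : ℕ) : Set (Equiv.Perm (Fin n)) →
    List (Set (Equiv.Perm (Fin n)) × Set (Equiv.Perm (Fin n))) →
    List (Equiv.Perm (Fin (n - m)))
  | _, [] => []
  | I, (K, I') :: l =>
      Sq m I I' (dcoset I I' (longest (simples n) K)) :: sqExpr m I' l

end TypeA

end

end CoreCoset

/-! Everything is translated into block permutations. Consecutive integers are grouped into the
blocks of `J`, encoded by the monotone function `bidx J`. A double coset is core exactly when it is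
the coset of a permutation `z` carrying the blocks of `J` increasingly onto blocks of `I`; this `z`
is its minimal element and `z * w_J` its maximal one (`isCore_iff`, `BlockPerm.maxElt_eq`). Minimal
and maximal elements are recognised by monotonicity on blocks, since a sorted sequence is determined
by its entries (`eq_of_lex_monotone`).

Squashing records how `z` permutes the blocks. Given one side, the squashed permutation determines
the other side and `z`, and every permutation of the blocks occurs (`BlockPerm.unique_left`,
`exists_blockPerm_left`). Lengths count inversions, so a product is reduced iff no pair is reversed
twice. A block permutation reverses no pair inside a block, and on other pairs this condition only
sees block indices; hence squashing preserves and reflects reducedness (`BlockPerm.lenAdd_iff`).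

Atomic cosets are those with a simple squash: such a coset exchanges two neighbouring blocks
(`BlockPerm.mem_simples_of_longest`, `BlockPerm.isAtomic`). Words in simple reflections therefore
lift uniquely, letter by letter, to chains of atomic steps, and induction along the chain matches
the two notions of reducedness. -/

namespace CoreCoset

variable {n : ℕ}

/-! ### Coxeter length as the number of inversions. -/

section Inversions

/-- The number of ordered pairs whose order is changed by `w`: twice the number of inversions. -/
def inv2 (w : Equiv.Perm (Fin n)) : ℕ :=
  ∑ i, ∑ j, if (i < j ↔ w i < w j) then 0 else 1

/-- The number of ordered pairs whose order is changed by `y` and changed back by `x`. -/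
def conflict (x y : Equiv.Perm (Fin n)) : ℕ :=
  ∑ i, ∑ j, if (i < j ↔ y i < y j) then 0 else if (i < j ↔ x (y i) < x (y j)) then 1 else 0

/-- After reindexing `inv2 x` along `y`, each pair can be checked alone: one reversed by both
factors is counted twice on the left and not at all by the product. Using ordered pairs makes the
reindexing possible without sorting each pair. -/
theorem inv2_add (x y : Equiv.Perm (Fin n)) :
    inv2 x + inv2 y = inv2 (x * y) + 2 * conflict x y := by
  have h : inv2 x = ∑ i, ∑ j, if (y i < y j ↔ x (y i) < x (y j)) then 0 else 1 := by
    unfold inv2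
    rw [← Equiv.sum_comp y]
    refine Finset.sum_congr rfl fun i _ => ?_
    rw [← Equiv.sum_comp y]
  rw [h]
  unfold inv2 conflict
  simp only [Finset.mul_sum, ← Finset.sum_add_distrib]
  refine Finset.sum_congr rfl fun i _ => Finset.sum_congr rfl fun j _ => ?_
  simp only [Equiv.Perm.mul_apply]
  by_cases h1 : i < j <;> by_cases h2 : y i < y j <;> by_cases h3 : x (y i) < x (y j) <;>
    simp [h1, h2, h3]

theorem inv2_one : inv2 (1 : Equiv.Perm (Fin n)) = 0 := by
  simp [inv2]

theorem inv2_inv (w : Equiv.Perm (Fin n)) : inv2 w⁻¹ = inv2 w := by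
  unfold inv2
  rw [← Equiv.sum_comp w]
  refine Finset.sum_congr rfl fun i _ => ?_
  rw [← Equiv.sum_comp w]
  refine Finset.sum_congr rfl fun j _ => ?_
  simp [iff_comm]

theorem conflict_eq_zero_iff (x y : Equiv.Perm (Fin n)) :
    conflict x y = 0 ↔ ∀ i j, i < j → y j < y i → x (y j) < x (y i) := by
  unfold conflict
  simp only [Finset.sum_eq_zero_iff, Finset.mem_univ, true_implies]
  constructor
  · intro h i j hij hy
    have := h i j
    rw [if_neg (by simp [hij, hy.le])] at this
    have h2 : ¬ x (y i) < x (y j) := by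
      intro h3; simp [hij, h3] at this
    exact lt_of_le_of_ne (not_lt.1 h2) (by simp [hij.ne'])
  · intro h i j
    rcases lt_trichotomy i j with hij | rfl | hij
    · rcases lt_or_ge (y i) (y j) with h1 | h1
      · simp [hij, h1]
      · have h1 : y j < y i := lt_of_le_of_ne h1 (by simp [hij.ne'])
        have := h i j hij h1
        simp [hij, h1.not_gt, this.not_gt]
    · simp
    · rcases lt_or_ge (y j) (y i) with h1 | h1
      · simp [hij.not_gt, h1.not_gt]
      · have h1 : y i < y j := lt_of_le_of_ne h1 (by simp [hij.ne'])
        have := h j i hij h1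
        simp [hij.not_gt, h1, this]

/-- An adjacent transposition reverses the order of its two points only. -/
theorem swap_lt_swap {i j : Fin n} (hij : (j : ℕ) = i + 1) {a b : Fin n} (hab : a < b)
    (h : ¬ (a = i ∧ b = j)) : Equiv.swap i j a < Equiv.swap i j b := by
  rw [Equiv.swap_apply_def, Equiv.swap_apply_def]
  simp only [Fin.ext_iff, Fin.lt_def] at *
  split_ifs <;> omega

theorem inv2_swap {i j : Fin n} (hij : (j : ℕ) = i + 1) : inv2 (Equiv.swap i j) = 2 := by
  have hlt : i < j := by rw [Fin.lt_def]; omega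
  have key : ∀ a b, (if (a < b ↔ Equiv.swap i j a < Equiv.swap i j b) then 0 else 1) =
      (if a = i then (if b = j then 1 else 0) else 0) +
        (if a = j then (if b = i then 1 else 0) else 0) := by
    intro a b
    by_cases h1 : a = i ∧ b = j
    · obtain ⟨rfl, rfl⟩ := h1
      simp [hlt, hlt.ne, hlt.not_gt]
    by_cases h2 : a = j ∧ b = i
    · obtain ⟨rfl, rfl⟩ := h2
      simp [hlt, hlt.ne', hlt.not_gt]
    have e1 : (if a = i then (if b = j then 1 else 0) else 0) = 0 := by
      split_ifs <;> simp_all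
    have e2 : (if a = j then (if b = i then 1 else 0) else 0) = 0 := by
      split_ifs <;> simp_all
    rw [e1, e2, if_pos]
    rcases lt_trichotomy a b with hab | rfl | hab
    · simp [hab, swap_lt_swap hij hab h1]
    · simp
    · simp [hab.not_gt, (swap_lt_swap hij hab (by tauto)).le]
  unfold inv2
  simp only [key, Finset.sum_add_distrib]
  simp

theorem inv2_mul_swap_of_lt {i j : Fin n} (hij : (j : ℕ) = i + 1) (w : Equiv.Perm (Fin n))
    (h : w i < w j) : inv2 (w * Equiv.swap i j) = inv2 w + 2 := by
  have := inv2_add w (Equiv.swap i j)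
  rw [inv2_swap hij, (conflict_eq_zero_iff _ _).2] at this
  · omega
  · intro a b hab hs
    by_cases h1 : a = i ∧ b = j
    · obtain ⟨rfl, rfl⟩ := h1
      simpa using h
    · exact absurd (swap_lt_swap hij hab h1) hs.not_gt

theorem inv2_mul_swap_of_gt {i j : Fin n} (hij : (j : ℕ) = i + 1) (w : Equiv.Perm (Fin n))
    (h : w j < w i) : inv2 (w * Equiv.swap i j) + 2 = inv2 w := by
  have := inv2_mul_swap_of_lt hij (w * Equiv.swap i j) (by simpa using h)
  rw [mul_assoc, Equiv.swap_mul_self, mul_one] at this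
  exact this.symm

/-- A transitive relation on an interval follows from its validity for neighbours. -/
theorem rel_of_adjacent {R : Fin n → Fin n → Prop} (htrans : ∀ a b c, R a b → R b c → R a c)
    {x y : Fin n} (hxy : x < y)
    (h : ∀ i j : Fin n, (j : ℕ) = i + 1 → x ≤ i → j ≤ y → R i j) : R x y := by
  obtain ⟨x, hx⟩ := x
  obtain ⟨y, hy⟩ := y
  simp only [Fin.lt_def] at hxy
  induction y, hxy using Nat.le_induction with
  | base => exact h _ _ rfl (by simp) (by simp)
  | succ k hk ih =>
    refine htrans _ ⟨k, by omega⟩ _ (ih (by omega) fun i j hij hi hj => h i j hij hi ?_)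
      (h _ _ rfl ?_ le_rfl)
    · simp only [Fin.le_def] at *; omega
    · simp only [Fin.le_def] at *; omega

theorem eq_one_of_ascending (w : Equiv.Perm (Fin n)) (h : ∀ i j, i < j → w i < w j) : w = 1 := by
  have := Tuple.unique_monotone (f := fun x : Fin n => x) (σ := w) (τ := 1)
    (fun a b hab => by
      rcases hab.lt_or_eq with h1 | rfl
      · exact (h a b h1).le
      · exact le_rfl) monotone_id
  ext x
  exact congrArg Fin.val (congrFun this x)

theorem exists_descent {w : Equiv.Perm (Fin n)} (hw : w ≠ 1) :
    ∃ i j : Fin n, (j : ℕ) = i + 1 ∧ w j < w i := by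
  by_contra hcon
  push Not at hcon
  refine hw (eq_one_of_ascending w fun i j hij => ?_)
  refine rel_of_adjacent (R := fun a b => w a < w b) (fun a b c => lt_trans) hij
    fun a b hab _ _ => lt_of_le_of_ne (hcon a b hab) ?_
  intro h
  have := w.injective h
  rw [this] at hab
  omega

theorem inv2_prod_le (l : List (Equiv.Perm (Fin n))) (hl : ∀ x ∈ l, x ∈ simples n) :
    inv2 l.prod ≤ 2 * l.length := by
  induction l with
  | nil => simp [inv2_one]
  | cons a l ih =>
    obtain ⟨i, j, hij, rfl⟩ := hl a (by simp)
    have h1 := inv2_add (Equiv.swap i j) l.prod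
    have h2 := ih fun x hx => hl x (by simp [hx])
    rw [inv2_swap hij] at h1
    simp only [List.prod_cons, List.length_cons]
    omega

theorem exists_word (w : Equiv.Perm (Fin n)) :
    ∃ l : List (Equiv.Perm (Fin n)), (∀ x ∈ l, x ∈ simples n) ∧ l.prod = w ∧
      2 * l.length = inv2 w := by
  induction hk : inv2 w using Nat.strong_induction_on generalizing w with
  | _ k ih =>
    by_cases hw : w = 1
    · subst hw
      exact ⟨[], by simp, by simp, by simp [← hk, inv2_one]⟩
    · obtain ⟨i, j, hij, hd⟩ := exists_descent hw
      have h1 := inv2_mul_swap_of_gt hij w hd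
      obtain ⟨l, hl, hp, hlen⟩ := ih _ (by omega) (w * Equiv.swap i j) rfl
      refine ⟨l ++ [Equiv.swap i j], ?_, ?_, ?_⟩
      · intro x hx
        rcases List.mem_append.1 hx with h | h
        · exact hl x h
        · rw [List.mem_singleton.1 h]
          exact ⟨i, j, hij, rfl⟩
      · rw [List.prod_append, hp, List.prod_singleton, mul_assoc, Equiv.swap_mul_self, mul_one]
      · simp only [List.length_append, List.length_singleton]
        omega

/-- Removing descents yields a word with half of `inv2 w` letters, and no word is shorter because
each letter raises `inv2` by at most 2. -/
theorem two_mul_len (w : Equiv.Perm (Fin n)) : 2 * len (simples n) w = inv2 w := by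
  obtain ⟨l, hl, hp, hlen⟩ := exists_word w
  have hne : {k | ∃ l : List (Equiv.Perm (Fin n)), (∀ x ∈ l, x ∈ simples n) ∧ l.prod = w ∧
      l.length = k}.Nonempty := ⟨_, l, hl, hp, rfl⟩
  apply le_antisymm
  · rw [← hlen]
    exact Nat.mul_le_mul_left 2 (Nat.sInf_le ⟨l, hl, hp, rfl⟩)
  · obtain ⟨l', hl', hp', hlen'⟩ := Nat.sInf_mem hne
    unfold len
    rw [← hlen', ← hp']
    exact inv2_prod_le l' hl'

theorem len_one : len (simples n) 1 = 0 := by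
  have := two_mul_len (1 : Equiv.Perm (Fin n))
  rw [inv2_one] at this
  omega

theorem len_inv (w : Equiv.Perm (Fin n)) : len (simples n) w⁻¹ = len (simples n) w := by
  have h1 := two_mul_len w
  have h2 := two_mul_len w⁻¹
  rw [inv2_inv] at h2
  omega

theorem len_mul_le (x y : Equiv.Perm (Fin n)) :
    len (simples n) (x * y) ≤ len (simples n) x + len (simples n) y := by
  have h1 := two_mul_len x
  have h2 := two_mul_len y
  have h3 := two_mul_len (x * y)
  have h4 := inv2_add x y
  omega

theorem len_of_mem_simples {w : Equiv.Perm (Fin n)} (hw : w ∈ simples n) :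
    len (simples n) w = 1 := by
  obtain ⟨i, j, hij, rfl⟩ := hw
  have h1 := two_mul_len (Equiv.swap i j)
  rw [inv2_swap hij] at h1
  omega

/-- The defect of additivity is `conflict x y`. This pointwise form is the one that can be compared
with a statement about blocks. -/
theorem lenAdd_iff (x y : Equiv.Perm (Fin n)) :
    LenAdd (simples n) x y ↔ ∀ i j, i < j → y j < y i → x (y j) < x (y i) := by
  rw [← conflict_eq_zero_iff]
  have h1 := two_mul_len x
  have h2 := two_mul_len y
  have h3 := two_mul_len (x * y)
  have h4 := inv2_add x y
  unfold LenAdd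
  omega

theorem len_lt_mul_swap {i j : Fin n} (hij : (j : ℕ) = i + 1) {w : Equiv.Perm (Fin n)}
    (h : w i < w j) : len (simples n) w < len (simples n) (w * Equiv.swap i j) := by
  have h1 := two_mul_len w
  have h2 := two_mul_len (w * Equiv.swap i j)
  rw [inv2_mul_swap_of_lt hij w h] at h2
  omega

theorem len_lt_swap_mul {i j : Fin n} (hij : (j : ℕ) = i + 1) {w : Equiv.Perm (Fin n)}
    (h : w⁻¹ i < w⁻¹ j) : len (simples n) w < len (simples n) (Equiv.swap i j * w) := by
  have := len_lt_mul_swap hij h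
  rwa [← len_inv, ← len_inv (w⁻¹ * _), mul_inv_rev, inv_inv, Equiv.swap_inv] at this

end Inversions

/-! ### Bruhat order and extremal elements. -/

section Bruhat

theorem BruhatLE.len_le {W : Type*} [Group W] {S : Set W} {x y : W} (h : BruhatLE S x y) :
    len S x ≤ len S y ∧ (len S y ≤ len S x → x = y) := by
  induction h with
  | refl => simp
  | tail _ h ih =>
    obtain ⟨g, s, hs, hy, hl⟩ := h
    exact ⟨by omega, fun h => by omega⟩

theorem BruhatLE.antisymm {W : Type*} [Group W] {S : Set W} {x y : W} (h : BruhatLE S x y)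
    (h' : BruhatLE S y x) : x = y :=
  h.len_le.2 h'.len_le.1

theorem minElt_eq_of_isLeast {W : Type*} [Group W] {S p : Set W} {x : W} (hx : x ∈ p)
    (h : ∀ y ∈ p, BruhatLE S x y) : minElt S p = x := by
  have hex : ∃ x ∈ p, ∀ y ∈ p, BruhatLE S x y := ⟨x, hx, h⟩
  unfold minElt
  rw [dif_pos hex]
  exact (hex.choose_spec.2 x hx).antisymm (h _ hex.choose_spec.1)

theorem maxElt_eq_of_isGreatest {W : Type*} [Group W] {S p : Set W} {x : W} (hx : x ∈ p)
    (h : ∀ y ∈ p, BruhatLE S y x) : maxElt S p = x := by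
  have hex : ∃ x ∈ p, ∀ y ∈ p, BruhatLE S y x := ⟨x, hx, h⟩
  unfold maxElt
  rw [dif_pos hex]
  exact (h _ hex.choose_spec.1).antisymm (hex.choose_spec.2 x hx)

theorem bruhatLE_mul_right {W : Type*} [Group W] {S : Set W} {x s : W} (hs : s ∈ S)
    (h : len S x < len S (x * s)) : BruhatLE S x (x * s) :=
  .single ⟨1, s, hs, by simp, h⟩

theorem bruhatLE_mul_left {W : Type*} [Group W] {S : Set W} {x s : W} (hs : s ∈ S)
    (h : len S x < len S (s * x)) : BruhatLE S x (s * x) :=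
  .single ⟨x⁻¹, s, hs, by group, h⟩

end Bruhat

/-! ### Components as fibres of the monotone function `bidx`. -/

section Blocks

open Classical in
/-- Auxiliary recursion for `bidx`, on natural numbers. -/
noncomputable def blockNat (J : Set (Equiv.Perm (Fin n))) : ℕ → ℕ
  | 0 => 0
  | k + 1 => blockNat J k +
      if ∃ i j : Fin n, (i : ℕ) = k ∧ (j : ℕ) = k + 1 ∧ Equiv.swap i j ∈ J then 0 else 1

/-- The index of the component of `x`: the number of `k < x` such that the transposition of `k`
and `k + 1` is not in `J`. -/
noncomputable def bidx (J : Set (Equiv.Perm (Fin n))) (x : Fin n) : ℕ := blockNat J x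

open Classical in
theorem bidx_succ (J : Set (Equiv.Perm (Fin n))) {i j : Fin n} (hij : (j : ℕ) = i + 1) :
    bidx J j = bidx J i + if Equiv.swap i j ∈ J then 0 else 1 := by
  unfold bidx
  rw [hij, blockNat]
  congr 1
  refine if_congr ⟨?_, fun h => ⟨i, j, rfl, hij, h⟩⟩ rfl rfl
  rintro ⟨a, b, ha, hb, h⟩
  obtain rfl : a = i := Fin.ext ha
  obtain rfl : b = j := Fin.ext (hb.trans hij.symm)
  exact h

theorem bidx_of_mem {J : Set (Equiv.Perm (Fin n))} {i j : Fin n} (hij : (j : ℕ) = i + 1)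
    (h : Equiv.swap i j ∈ J) : bidx J j = bidx J i := by
  rw [bidx_succ J hij, if_pos h, add_zero]

theorem bidx_of_notMem {J : Set (Equiv.Perm (Fin n))} {i j : Fin n} (hij : (j : ℕ) = i + 1)
    (h : Equiv.swap i j ∉ J) : bidx J j = bidx J i + 1 := by
  rw [bidx_succ J hij, if_neg h]

theorem mem_iff_bidx {J : Set (Equiv.Perm (Fin n))} {i j : Fin n} (hij : (j : ℕ) = i + 1) :
    Equiv.swap i j ∈ J ↔ bidx J i = bidx J j := by
  by_cases h : Equiv.swap i j ∈ J
  · simp [h, bidx_of_mem hij h]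
  · simp [h, bidx_of_notMem hij h]

theorem bidx_mono (J : Set (Equiv.Perm (Fin n))) : Monotone (bidx J) := by
  intro x y hxy
  rcases hxy.lt_or_eq with h | rfl
  · refine rel_of_adjacent (R := fun a b => bidx J a ≤ bidx J b) (fun a b c => le_trans) h ?_
    intro i j hij _ _
    rw [bidx_succ J hij]
    omega
  · exact le_rfl

theorem lt_of_bidx_lt {J : Set (Equiv.Perm (Fin n))} {x y : Fin n} (h : bidx J x < bidx J y) :
    x < y :=
  (bidx_mono J).reflect_lt h

theorem bidx_injective {I J : Set (Equiv.Perm (Fin n))} (hI : I ⊆ simples n)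
    (hJ : J ⊆ simples n) (h : ∀ x, bidx I x = bidx J x) : I = J := by
  ext w
  constructor
  · intro hw
    obtain ⟨i, j, hij, rfl⟩ := hI hw
    rw [mem_iff_bidx hij] at hw ⊢
    rwa [← h, ← h]
  · intro hw
    obtain ⟨i, j, hij, rfl⟩ := hJ hw
    rw [mem_iff_bidx hij] at hw ⊢
    rwa [h, h]

theorem swap_adjacent_injective {i j i' j' : Fin n} (hij : (j : ℕ) = i + 1)
    (hij' : (j' : ℕ) = i' + 1) (h : Equiv.swap i j = Equiv.swap i' j') : i = i' ∧ j = j' := by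
  have h1 : Equiv.swap i' j' i = j := by rw [← h, Equiv.swap_apply_left]
  rw [Equiv.swap_apply_def] at h1
  simp only [Fin.ext_iff] at *
  split_ifs at h1 <;> omega

/-- The elements of the parabolic subgroup of `J` are the permutations preserving the components
of `J`. -/
theorem mem_closure_iff {J : Set (Equiv.Perm (Fin n))} (hJ : J ⊆ simples n)
    (y : Equiv.Perm (Fin n)) :
    y ∈ Subgroup.closure J ↔ ∀ x, bidx J (y x) = bidx J x := by
  constructor
  · intro h
    induction h using Subgroup.closure_induction with
    | mem s hs =>
      obtain ⟨i, j, hij, rfl⟩ := hJ hs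
      intro x
      have := bidx_of_mem hij hs
      rw [Equiv.swap_apply_def]
      split_ifs with h1 h2
      · rw [h1, this]
      · rw [h2, this]
      · rfl
    | one => simp
    | mul a b _ _ ha hb => intro x; rw [Equiv.Perm.mul_apply, ha, hb]
    | inv a _ ha => intro x; rw [← ha (a⁻¹ x), show a (a⁻¹ x) = x from a.apply_symm_apply x]
  · induction hk : inv2 y using Nat.strong_induction_on generalizing y with
    | _ k ih =>
      intro h
      by_cases hy : y = 1
      · rw [hy]; exact Subgroup.one_mem _
      obtain ⟨i, j, hij, hd⟩ := exists_descent hy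
      have hlt : i < j := by rw [Fin.lt_def]; omega
      -- A descent of a block-preserving permutation lies inside one block, as `bidx J` is monotone;
      -- so it can be removed by a generator from `J`.
      have hb : bidx J i = bidx J j := le_antisymm (bidx_mono J hlt.le) <| by
        rw [← h i, ← h j]; exact bidx_mono J hd.le
      have hs : Equiv.swap i j ∈ J := (mem_iff_bidx hij).2 hb
      have h1 := inv2_mul_swap_of_gt hij y hd
      have h2 := ih _ (by omega) (y * Equiv.swap i j) rfl (by
        intro x
        rw [Equiv.Perm.mul_apply, h, Equiv.swap_apply_def]
        split_ifs with h1 h2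
        · rw [h1, hb]
        · rw [h2, hb]
        · rfl)
      have := Subgroup.mul_mem _ h2 (Subgroup.subset_closure hs)
      rwa [mul_assoc, Equiv.swap_mul_self, mul_one] at this

theorem mem_dcoset_iff {I J : Set (Equiv.Perm (Fin n))} (hI : I ⊆ simples n)
    (hJ : J ⊆ simples n) (w y : Equiv.Perm (Fin n)) :
    y ∈ dcoset I J w ↔ ∃ u v : Equiv.Perm (Fin n), (∀ x, bidx I (u x) = bidx I x) ∧
      (∀ x, bidx J (v x) = bidx J x) ∧ y = u * w * v := by
  unfold dcoset
  simp only [DoubleCoset.mem_doubleCoset, SetLike.mem_coe, mem_closure_iff hI,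
    mem_closure_iff hJ]
  grind

theorem exists_bidx_jump (J : Set (Equiv.Perm (Fin n))) {c : ℕ} {x : Fin n} (h : c < bidx J x) :
    ∃ i j : Fin n, (j : ℕ) = i + 1 ∧ bidx J i = c ∧ bidx J j = c + 1 := by
  obtain ⟨k, hk⟩ := x
  induction k with
  | zero => simp [bidx, blockNat] at h
  | succ k ih =>
    by_cases h1 : c < bidx J ⟨k, by omega⟩
    · exact ih _ h1
    · have := bidx_succ J (i := ⟨k, by omega⟩) (j := ⟨k + 1, hk⟩) rfl
      refine ⟨⟨k, by omega⟩, ⟨k + 1, hk⟩, rfl, ?_, ?_⟩ <;> split_ifs at this <;> omega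

theorem exists_bidx_eq_of_le (J : Set (Equiv.Perm (Fin n))) {c : ℕ} {x : Fin n}
    (h : c ≤ bidx J x) : ∃ z, bidx J z = c := by
  rcases h.lt_or_eq with h | rfl
  · obtain ⟨i, _, _, hi, _⟩ := exists_bidx_jump J h
    exact ⟨i, hi⟩
  · exact ⟨x, rfl⟩

/-- A monotone function with values `0, 1, …, k` is the function of component indices of the
set of transpositions of neighbours with the same value. -/
theorem exists_bidx_eq {f : Fin n → ℕ} (hf : Monotone f)
    (hs : ∀ x, ∀ c ≤ f x, ∃ z, f z = c) :
    ∃ I ⊆ simples n, ∀ x, bidx I x = f x := by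
  refine ⟨{w | ∃ i j : Fin n, (j : ℕ) = i + 1 ∧ w = Equiv.swap i j ∧ f i = f j}, ?_, ?_⟩
  · rintro w ⟨i, j, hij, rfl, -⟩
    exact ⟨i, j, hij, rfl⟩
  · rintro ⟨k, hk⟩
    induction k with
    | zero =>
      obtain ⟨z, hz⟩ := hs ⟨0, hk⟩ 0 (Nat.zero_le _)
      have := hf (show (⟨0, hk⟩ : Fin n) ≤ z from Nat.zero_le _)
      simp only [bidx, blockNat]
      omega
    | succ k ih =>
      have hle := hf (show (⟨k, by omega⟩ : Fin n) ≤ ⟨k + 1, hk⟩ from Nat.le_succ _)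
      by_cases h : f ⟨k, by omega⟩ = f ⟨k + 1, hk⟩
      · rw [bidx_of_mem (i := ⟨k, by omega⟩) rfl, ih, h]
        exact ⟨_, _, rfl, rfl, h⟩
      · rw [bidx_of_notMem (i := ⟨k, by omega⟩) rfl, ih]
        -- No value is skipped: the point taking the value `f k + 1` can lie neither at or before
        -- `k` nor at or after `k + 1` unless `f` jumps by exactly one.
        · obtain ⟨z, hz⟩ := hs ⟨k + 1, hk⟩ (f ⟨k, by omega⟩ + 1) (by omega)
          by_contra hne
          rcases le_or_gt (k + 1) (z : ℕ) with h1 | h1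
          · have := hf (show (⟨k + 1, hk⟩ : Fin n) ≤ z from h1)
            omega
          · have := hf (show z ≤ (⟨k, by omega⟩ : Fin n) from Nat.le_of_lt_succ h1)
            omega
        · rintro ⟨i, j, hij, hw, he⟩
          obtain ⟨rfl, rfl⟩ := swap_adjacent_injective rfl hij hw
          exact h he

/-- Each of the `x` adjacent transpositions up to `x` either belongs to `J` or contributes one to
`bidx J x`. -/
theorem bidx_add_ncard {J : Set (Equiv.Perm (Fin n))} (x : Fin n) :
    bidx J x + {w ∈ J | ∃ i j : Fin n, (j : ℕ) = i + 1 ∧ j ≤ x ∧ w = Equiv.swap i j}.ncard =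
      x := by
  obtain ⟨k, hk⟩ := x
  induction k with
  | zero =>
    have : {w ∈ J | ∃ i j : Fin n, (j : ℕ) = i + 1 ∧ j ≤ ⟨0, hk⟩ ∧ w = Equiv.swap i j} = ∅ := by
      ext w
      simp only [Set.mem_ofPred_eq, Fin.le_def, Set.mem_empty_iff_false, iff_false]
      rintro ⟨-, i, j, hij, hj, -⟩
      omega
    rw [this]
    simp [bidx, blockNat]
  | succ k ih =>
    set i : Fin n := ⟨k, by omega⟩ with hi
    set j : Fin n := ⟨k + 1, hk⟩ with hj
    replace ih : bidx J i + {w ∈ J | ∃ a b : Fin n, (b : ℕ) = a + 1 ∧ b ≤ i ∧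
        w = Equiv.swap a b}.ncard = k := ih (by omega)
    have hjk : (j : ℕ) = k + 1 := rfl
    have hij : (j : ℕ) = i + 1 := rfl
    by_cases h : Equiv.swap i j ∈ J
    · have : {w ∈ J | ∃ a b : Fin n, (b : ℕ) = a + 1 ∧ b ≤ j ∧ w = Equiv.swap a b} =
          insert (Equiv.swap i j)
            {w ∈ J | ∃ a b : Fin n, (b : ℕ) = a + 1 ∧ b ≤ i ∧ w = Equiv.swap a b} := by
        ext w
        simp only [Set.mem_ofPred_eq, Set.mem_insert_iff]
        constructor
        · rintro ⟨hw, a, b, hab, hb, rfl⟩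
          by_cases h1 : b ≤ i
          · exact Or.inr ⟨hw, a, b, hab, h1, rfl⟩
          · left
            simp only [Fin.le_def] at *
            congr 1 <;> apply Fin.ext <;> omega
        · rintro (rfl | ⟨hw, a, b, hab, hb, rfl⟩)
          · exact ⟨h, i, j, hij, le_rfl, rfl⟩
          · refine ⟨hw, a, b, hab, ?_, rfl⟩
            simp only [Fin.le_def] at *
            omega
      rw [this, Set.ncard_insert_of_notMem, bidx_of_mem hij h, hjk]
      · omega
      · rintro ⟨-, a, b, hab, hb, hw⟩
        obtain ⟨rfl, rfl⟩ := swap_adjacent_injective hij hab hw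
        simp only [Fin.le_def] at *
        omega
    · have : {w ∈ J | ∃ a b : Fin n, (b : ℕ) = a + 1 ∧ b ≤ j ∧ w = Equiv.swap a b} =
            {w ∈ J | ∃ a b : Fin n, (b : ℕ) = a + 1 ∧ b ≤ i ∧ w = Equiv.swap a b} := by
        ext w
        simp only [Set.mem_ofPred_eq]
        constructor
        · rintro ⟨hw, a, b, hab, hb, rfl⟩
          refine ⟨hw, a, b, hab, ?_, rfl⟩
          by_contra h1
          apply h
          convert hw using 2 <;> apply Fin.ext <;> simp only [Fin.le_def] at * <;> omega
        · rintro ⟨hw, a, b, hab, hb, rfl⟩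
          refine ⟨hw, a, b, hab, ?_, rfl⟩
          simp only [Fin.le_def] at *
          omega
      rw [this, bidx_of_notMem hij h, hjk]
      omega

/-- The component indices are the numbers below `n - #J`. -/
theorem exists_bidx_eq_iff {J : Set (Equiv.Perm (Fin n))} (hJ : J ⊆ simples n) (c : ℕ) :
    (∃ x, bidx J x = c) ↔ c < n - J.ncard := by
  rcases Nat.eq_zero_or_pos n with rfl | hn
  · simp
  set x : Fin n := ⟨n - 1, by omega⟩ with hx
  have hall : {w ∈ J | ∃ i j : Fin n, (j : ℕ) = i + 1 ∧ j ≤ x ∧ w = Equiv.swap i j} = J := by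
    ext w
    simp only [Set.mem_ofPred_eq, and_iff_left_iff_imp]
    intro hw
    obtain ⟨i, j, hij, rfl⟩ := hJ hw
    exact ⟨i, j, hij, by rw [Fin.le_def]; simp only [hx]; omega, rfl⟩
  have h := bidx_add_ncard (J := J) x
  rw [hall] at h
  simp only [hx] at h
  constructor
  · rintro ⟨z, rfl⟩
    have := bidx_mono J (show z ≤ x by rw [Fin.le_def]; simp only [hx]; omega)
    simp only [hx] at this
    omega
  · intro hc
    exact exists_bidx_eq_of_le J (x := x) (by simp only [hx]; omega)

/-- Between two points with equal `bidx` the function is constant by monotonicity, so all adjacent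
transpositions in between lie in `J`. -/
theorem component_eq (J : Set (Equiv.Perm (Fin n))) (x : Fin n) :
    component J x = {z | bidx J z = bidx J x} := by
  have hlt : ∀ {x y : Fin n}, x < y → bidx J x = bidx J y →
      Relation.EqvGen (fun i j : Fin n => (j : ℕ) = i + 1 ∧ Equiv.swap i j ∈ J) x y := by
    intro x y hxy hb
    refine rel_of_adjacent (fun a b c => Relation.EqvGen.trans a b c) hxy ?_
    intro i j hij hi hj
    refine .rel _ _ ⟨hij, (mem_iff_bidx hij).2 (le_antisymm (bidx_mono J ?_) ?_)⟩
    · rw [Fin.le_def]; omega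
    · exact (bidx_mono J hj).trans (hb.symm.le.trans (bidx_mono J hi))
  ext z
  simp only [component, Set.mem_ofPred_eq]
  constructor
  · intro h
    induction h with
    | rel a b h => exact bidx_of_mem h.1 h.2
    | refl a => rfl
    | symm a b _ ih => exact ih.symm
    | trans a b c _ _ ih1 ih2 => exact ih2.trans ih1
  · intro h
    rcases lt_trichotomy x z with h1 | rfl | h1
    · exact hlt h1 h.symm
    · exact .refl _
    · exact .symm _ _ (hlt h1 h)

/-- The components to the left of `x` are the fibres of `bidx J` over the values below `bidx J x`,
all of which are attained. -/
theorem compIndex_eq (J : Set (Equiv.Perm (Fin n))) (x : Fin n) : compIndex J x = bidx J x := by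
  have hset : {C : Set (Fin n) | (∃ z, C = component J z) ∧
      ∀ a ∈ C, ∀ b ∈ component J x, a < b} =
      (fun c => {z | bidx J z = c}) '' Set.Iio (bidx J x) := by
    ext C
    simp only [component_eq, Set.mem_ofPred_eq, Set.mem_image, Set.mem_Iio]
    constructor
    · rintro ⟨⟨z, rfl⟩, h⟩
      refine ⟨bidx J z, ?_, rfl⟩
      have h1 := h z rfl x rfl
      refine lt_of_le_of_ne (bidx_mono J h1.le) fun he => ?_
      exact lt_irrefl x (h x he.symm x rfl)
    · rintro ⟨c, hc, rfl⟩
      obtain ⟨z, hz⟩ := exists_bidx_eq_of_le J hc.le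
      refine ⟨⟨z, by rw [hz]⟩, fun a ha b hb => lt_of_bidx_lt (J := J) ?_⟩
      rw [ha, hb]
      exact hc
  unfold compIndex
  rw [hset, Set.InjOn.ncard_image]
  · rw [← Finset.coe_Iio, Set.ncard_coe_finset, Nat.card_Iio]
  · intro c hc d _ h
    obtain ⟨z, hz⟩ := exists_bidx_eq_of_le J (le_of_lt hc)
    have : z ∈ {z | bidx J z = d} := (Set.ext_iff.1 h z).1 hz
    exact hz.symm.trans this

end Blocks

/-! ### Minimal and maximal elements of double cosets. -/

section Extremal

/-- `z` is increasing on the components of `J`. -/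
def IncOn (J : Set (Equiv.Perm (Fin n))) (z : Equiv.Perm (Fin n)) : Prop :=
  ∀ x y, x < y → bidx J x = bidx J y → z x < z y

/-- `z` is decreasing on the components of `J`. -/
def DecOn (J : Set (Equiv.Perm (Fin n))) (z : Equiv.Perm (Fin n)) : Prop :=
  ∀ x y, x < y → bidx J x = bidx J y → z y < z x

theorem swap_mem_of_between {J : Set (Equiv.Perm (Fin n))} {x y i j : Fin n}
    (hb : bidx J x = bidx J y) (hij : (j : ℕ) = i + 1) (hi : x ≤ i) (hj : j ≤ y) :
    Equiv.swap i j ∈ J := by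
  refine (mem_iff_bidx hij).2 (le_antisymm (bidx_mono J ?_) ?_)
  · rw [Fin.le_def]; omega
  · exact (bidx_mono J hj).trans (hb.symm.le.trans (bidx_mono J hi))

theorem incOn_of_adjacent {J : Set (Equiv.Perm (Fin n))} {z : Equiv.Perm (Fin n)}
    (h : ∀ i j : Fin n, (j : ℕ) = i + 1 → Equiv.swap i j ∈ J → ¬ z j < z i) : IncOn J z := by
  intro x y hxy hb
  refine rel_of_adjacent (R := fun a b => z a < z b) (fun _ _ _ => lt_trans) hxy ?_
  intro i j hij hi hj
  refine lt_of_le_of_ne (not_lt.1 (h i j hij (swap_mem_of_between hb hij hi hj))) ?_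
  intro he
  have := z.injective he
  rw [this] at hij
  omega

theorem decOn_of_adjacent {J : Set (Equiv.Perm (Fin n))} {z : Equiv.Perm (Fin n)}
    (h : ∀ i j : Fin n, (j : ℕ) = i + 1 → Equiv.swap i j ∈ J → ¬ z i < z j) : DecOn J z := by
  intro x y hxy hb
  refine rel_of_adjacent (R := fun a b => z b < z a) (fun _ _ _ h1 h2 => h2.trans h1) hxy ?_
  intro i j hij hi hj
  refine lt_of_le_of_ne (not_lt.1 (h i j hij (swap_mem_of_between hb hij hi hj))) ?_
  intro he
  have := z.injective he
  rw [this] at hij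
  omega

theorem mul_mem_dcoset {I J : Set (Equiv.Perm (Fin n))} {w y s : Equiv.Perm (Fin n)}
    (hy : y ∈ dcoset I J w) (hs : s ∈ Subgroup.closure J) : y * s ∈ dcoset I J w := by
  unfold dcoset at *
  rw [DoubleCoset.mem_doubleCoset] at *
  obtain ⟨a, ha, b, hb, rfl⟩ := hy
  exact ⟨a, ha, b * s, Subgroup.mul_mem _ hb hs, by group⟩

theorem mul_mem_dcoset_left {I J : Set (Equiv.Perm (Fin n))} {w y s : Equiv.Perm (Fin n)}
    (hy : y ∈ dcoset I J w) (hs : s ∈ Subgroup.closure I) : s * y ∈ dcoset I J w := by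
  unfold dcoset at *
  rw [DoubleCoset.mem_doubleCoset] at *
  obtain ⟨a, ha, b, hb, rfl⟩ := hy
  exact ⟨s * a, Subgroup.mul_mem _ hs ha, b, hb, by group⟩

theorem self_mem_dcoset (I J : Set (Equiv.Perm (Fin n))) (w : Equiv.Perm (Fin n)) :
    w ∈ dcoset I J w :=
  DoubleCoset.mem_doubleCoset.2 ⟨1, Subgroup.one_mem _, 1, Subgroup.one_mem _, by group⟩

theorem dcoset_eq_of_mem {I J : Set (Equiv.Perm (Fin n))} {w y : Equiv.Perm (Fin n)}
    (h : y ∈ dcoset I J w) : dcoset I J y = dcoset I J w :=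
  DoubleCoset.doubleCoset_eq_of_mem h

theorem mem_dcoset_same {J : Set (Equiv.Perm (Fin n))} {y : Equiv.Perm (Fin n)} :
    y ∈ dcoset J J 1 ↔ y ∈ Subgroup.closure J := by
  unfold dcoset
  rw [DoubleCoset.mem_doubleCoset]
  constructor
  · rintro ⟨a, ha, b, hb, rfl⟩
    rw [mul_one]
    exact Subgroup.mul_mem _ ha hb
  · intro h
    exact ⟨y, h, 1, Subgroup.one_mem _, by group⟩

/-- Sorting twice gives uniqueness. The labels in `h1` and `h2` differ by the rearrangement `v` and
are both sorted, so they agree, and `z`, `z'` send each point to the same block of `I`. Then `z *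
z'⁻¹` preserves these blocks and rearranges the labels in `h3` into those in `h4`; being sorted,
these agree too, and `r'` recovers the inverse permutations. The label maps allow both the usual
order (minimal elements) and its dual (maximal elements). -/
theorem eq_of_lex_monotone {I J : Set (Equiv.Perm (Fin n))} {L L' : Type*} [PartialOrder L]
    [PartialOrder L'] {r : ℕ → L} (hr : r.Injective) {r' : Fin n → L'} (hr' : r'.Injective)
    {z z' u v : Equiv.Perm (Fin n)} (hu : ∀ x, bidx I (u x) = bidx I x)
    (hv : ∀ x, bidx J (v x) = bidx J x) (he : z' = u * z * v)
    (h1 : Monotone fun x => toLex (bidx J x, r (bidx I (z x))))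
    (h2 : Monotone fun x => toLex (bidx J x, r (bidx I (z' x))))
    (h3 : Monotone fun x => toLex (bidx I x, r' (z⁻¹ x)))
    (h4 : Monotone fun x => toLex (bidx I x, r' (z'⁻¹ x))) : z' = z := by
  have h2' : (fun x => toLex (bidx J x, r (bidx I (z' x)))) =
      (fun x => toLex (bidx J x, r (bidx I (z x)))) ∘ v := by
    funext x
    simp [he, hu, hv]
  have e1 := Tuple.unique_monotone
    (f := fun x => toLex (bidx J x, r (bidx I (z x)))) (σ := v) (τ := 1) (by rw [← h2']; exact h2) h1
  rw [← h2'] at e1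
  have e1 : ∀ x, bidx I (z' x) = bidx I (z x) := by
    intro x
    have := congrArg (fun p => (ofLex p).2) (congrFun e1 x)
    exact hr this
  have e2 : ∀ y, bidx I (z (z'⁻¹ y)) = bidx I y := by
    intro y
    rw [← e1]
    simp
  have h4' : (fun x => toLex (bidx I x, r' (z'⁻¹ x))) =
      (fun x => toLex (bidx I x, r' (z⁻¹ x))) ∘ (z * z'⁻¹ : Equiv.Perm (Fin n)) := by
    funext x
    have := e2 x
    simp only [Equiv.Perm.coe_inv] at this
    simp [this]
  have e3 := Tuple.unique_monotone
    (f := fun x => toLex (bidx I x, r' (z⁻¹ x))) (σ := z * z'⁻¹) (τ := 1) (by rw [← h4']; exact h4) h3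
  rw [← h4'] at e3
  rw [← inv_inj]
  ext y : 1
  have := congrArg (fun p => (ofLex p).2) (congrFun e3 y)
  exact hr' this

theorem eq_of_incOn {I J : Set (Equiv.Perm (Fin n))} (hI : I ⊆ simples n) (hJ : J ⊆ simples n)
    {z z' : Equiv.Perm (Fin n)} (hmem : z' ∈ dcoset I J z) (h1 : IncOn J z)
    (h2 : IncOn I z⁻¹) (h1' : IncOn J z') (h2' : IncOn I z'⁻¹) : z' = z := by
  obtain ⟨u, v, hu, hv, he⟩ := (mem_dcoset_iff hI hJ _ _).1 hmem
  have m1 : ∀ {z}, IncOn J z → Monotone fun x => toLex (bidx J x, bidx I (z x)) := by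
    intro z hz x y hxy
    rw [Prod.Lex.toLex_le_toLex]
    rcases (bidx_mono J hxy).lt_or_eq with h | h
    · exact Or.inl h
    · rcases hxy.lt_or_eq with hxy | rfl
      · exact Or.inr ⟨h, bidx_mono I (hz x y hxy h).le⟩
      · exact Or.inr ⟨h, le_rfl⟩
  have m2 : ∀ {z}, IncOn I z → Monotone fun x => toLex (bidx I x, z x) := by
    intro z hz x y hxy
    rw [Prod.Lex.toLex_le_toLex]
    rcases (bidx_mono I hxy).lt_or_eq with h | h
    · exact Or.inl h
    · rcases hxy.lt_or_eq with hxy | rfl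
      · exact Or.inr ⟨h, (hz x y hxy h).le⟩
      · exact Or.inr ⟨h, le_rfl⟩
  exact eq_of_lex_monotone (r := id) (r' := id) Function.injective_id Function.injective_id hu hv
    he (m1 h1) (m1 h1') (m2 h2) (m2 h2')

theorem eq_of_decOn {I J : Set (Equiv.Perm (Fin n))} (hI : I ⊆ simples n) (hJ : J ⊆ simples n)
    {z z' : Equiv.Perm (Fin n)} (hmem : z' ∈ dcoset I J z) (h1 : DecOn J z)
    (h2 : DecOn I z⁻¹) (h1' : DecOn J z') (h2' : DecOn I z'⁻¹) : z' = z := by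
  obtain ⟨u, v, hu, hv, he⟩ := (mem_dcoset_iff hI hJ _ _).1 hmem
  have m1 : ∀ {z}, DecOn J z →
      Monotone fun x => toLex (bidx J x, OrderDual.toDual (bidx I (z x))) := by
    intro z hz x y hxy
    rw [Prod.Lex.toLex_le_toLex]
    rcases (bidx_mono J hxy).lt_or_eq with h | h
    · exact Or.inl h
    · rcases hxy.lt_or_eq with hxy | rfl
      · exact Or.inr ⟨h, OrderDual.toDual_le_toDual.2 (bidx_mono I (hz x y hxy h).le)⟩
      · exact Or.inr ⟨h, le_rfl⟩
  have m2 : ∀ {z}, DecOn I z → Monotone fun x => toLex (bidx I x, OrderDual.toDual (z x)) := by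
    intro z hz x y hxy
    rw [Prod.Lex.toLex_le_toLex]
    rcases (bidx_mono I hxy).lt_or_eq with h | h
    · exact Or.inl h
    · rcases hxy.lt_or_eq with hxy | rfl
      · exact Or.inr ⟨h, OrderDual.toDual_le_toDual.2 (hz x y hxy h).le⟩
      · exact Or.inr ⟨h, le_rfl⟩
  exact eq_of_lex_monotone OrderDual.toDual.injective OrderDual.toDual.injective hu hv
    he (m1 h1) (m1 h1') (m2 h2) (m2 h2')

/-- Descents in `J` on the right or in `I` on the left are removed one at a time; each removal stays
in the coset and goes down in Bruhat order. -/
theorem exists_incOn_le {I J : Set (Equiv.Perm (Fin n))} (hI : I ⊆ simples n)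
    (hJ : J ⊆ simples n) {w y : Equiv.Perm (Fin n)} (hy : y ∈ dcoset I J w) :
    ∃ z ∈ dcoset I J w, IncOn J z ∧ IncOn I z⁻¹ ∧ BruhatLE (simples n) z y := by
  induction hk : len (simples n) y using Nat.strong_induction_on generalizing y with
  | _ k ih =>
    by_cases h1 : ∃ i j : Fin n, (j : ℕ) = i + 1 ∧ Equiv.swap i j ∈ J ∧ y j < y i
    · obtain ⟨i, j, hij, hs, hd⟩ := h1
      have hl := len_lt_mul_swap hij (w := y * Equiv.swap i j) (by simpa using hd)
      have hb := bruhatLE_mul_right (hJ hs) hl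
      rw [mul_assoc, Equiv.swap_mul_self, mul_one] at hl hb
      obtain ⟨z, hz, h2, h3, h4⟩ := ih _ (hk ▸ hl)
        (mul_mem_dcoset hy (Subgroup.subset_closure hs)) rfl
      exact ⟨z, hz, h2, h3, h4.trans hb⟩
    by_cases h2 : ∃ i j : Fin n, (j : ℕ) = i + 1 ∧ Equiv.swap i j ∈ I ∧ y⁻¹ j < y⁻¹ i
    · obtain ⟨i, j, hij, hs, hd⟩ := h2
      have hl := len_lt_swap_mul hij (w := Equiv.swap i j * y) (by simpa using hd)
      have hb := bruhatLE_mul_left (hI hs) hl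
      rw [← mul_assoc, Equiv.swap_mul_self, one_mul] at hl hb
      obtain ⟨z, hz, h2, h3, h4⟩ := ih _ (hk ▸ hl)
        (mul_mem_dcoset_left hy (Subgroup.subset_closure hs)) rfl
      exact ⟨z, hz, h2, h3, h4.trans hb⟩
    exact ⟨y, hy, incOn_of_adjacent fun i j hij hs hd => h1 ⟨i, j, hij, hs, hd⟩,
      incOn_of_adjacent fun i j hij hs hd => h2 ⟨i, j, hij, hs, hd⟩, .refl⟩

theorem exists_decOn_ge {I J : Set (Equiv.Perm (Fin n))} (hI : I ⊆ simples n)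
    (hJ : J ⊆ simples n) {w y : Equiv.Perm (Fin n)} (hy : y ∈ dcoset I J w) :
    ∃ z ∈ dcoset I J w, DecOn J z ∧ DecOn I z⁻¹ ∧ BruhatLE (simples n) y z := by
  -- Ascents are now filled in, so termination needs an upper bound for the length, supplied by
  -- finiteness of the group.
  obtain ⟨N, hN⟩ := (Set.finite_range (len (simples n))).bddAbove
  replace hN : ∀ w, len (simples n) w ≤ N := fun w => hN ⟨w, rfl⟩
  induction hk : N - len (simples n) y using Nat.strong_induction_on generalizing y with
  | _ k ih =>
    by_cases h1 : ∃ i j : Fin n, (j : ℕ) = i + 1 ∧ Equiv.swap i j ∈ J ∧ y i < y j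
    · obtain ⟨i, j, hij, hs, hd⟩ := h1
      have hl := len_lt_mul_swap hij hd
      have hb := bruhatLE_mul_right (hJ hs) hl
      have := hN (y * Equiv.swap i j)
      obtain ⟨z, hz, h2, h3, h4⟩ := ih _ (by omega)
        (mul_mem_dcoset hy (Subgroup.subset_closure hs)) rfl
      exact ⟨z, hz, h2, h3, hb.trans h4⟩
    by_cases h2 : ∃ i j : Fin n, (j : ℕ) = i + 1 ∧ Equiv.swap i j ∈ I ∧ y⁻¹ i < y⁻¹ j
    · obtain ⟨i, j, hij, hs, hd⟩ := h2
      have hl := len_lt_swap_mul hij hd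
      have hb := bruhatLE_mul_left (hI hs) hl
      have := hN (Equiv.swap i j * y)
      obtain ⟨z, hz, h2, h3, h4⟩ := ih _ (by omega)
        (mul_mem_dcoset_left hy (Subgroup.subset_closure hs)) rfl
      exact ⟨z, hz, h2, h3, hb.trans h4⟩
    exact ⟨y, hy, decOn_of_adjacent fun i j hij hs hd => h1 ⟨i, j, hij, hs, hd⟩,
      decOn_of_adjacent fun i j hij hs hd => h2 ⟨i, j, hij, hs, hd⟩, .refl⟩

/-- The minimal element of a double coset is its only element without descents in `I` on the left
and in `J` on the right. -/
theorem minElt_eq {I J : Set (Equiv.Perm (Fin n))} (hI : I ⊆ simples n)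
    (hJ : J ⊆ simples n) {w z : Equiv.Perm (Fin n)} (hz : z ∈ dcoset I J w)
    (h1 : IncOn J z) (h2 : IncOn I z⁻¹) : minElt (simples n) (dcoset I J w) = z := by
  refine minElt_eq_of_isLeast hz fun y hy => ?_
  obtain ⟨z', hz', h1', h2', h⟩ := exists_incOn_le hI hJ hy
  rw [← dcoset_eq_of_mem hz] at hz'
  rwa [← eq_of_incOn hI hJ hz' h1 h2 h1' h2']

theorem maxElt_eq {I J : Set (Equiv.Perm (Fin n))} (hI : I ⊆ simples n)
    (hJ : J ⊆ simples n) {w z : Equiv.Perm (Fin n)} (hz : z ∈ dcoset I J w)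
    (h1 : DecOn J z) (h2 : DecOn I z⁻¹) : maxElt (simples n) (dcoset I J w) = z := by
  refine maxElt_eq_of_isGreatest hz fun y hy => ?_
  obtain ⟨z', hz', h1', h2', h⟩ := exists_decOn_ge hI hJ hy
  rw [← dcoset_eq_of_mem hz] at hz'
  rwa [← eq_of_decOn hI hJ hz' h1 h2 h1' h2']

theorem minElt_spec {I J : Set (Equiv.Perm (Fin n))} (hI : I ⊆ simples n)
    (hJ : J ⊆ simples n) (w : Equiv.Perm (Fin n)) :
    minElt (simples n) (dcoset I J w) ∈ dcoset I J w ∧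
      IncOn J (minElt (simples n) (dcoset I J w)) ∧
      IncOn I (minElt (simples n) (dcoset I J w))⁻¹ := by
  obtain ⟨z, hz, h1, h2, -⟩ := exists_incOn_le hI hJ (self_mem_dcoset I J w)
  rw [minElt_eq hI hJ hz h1 h2]
  exact ⟨hz, h1, h2⟩

theorem DecOn.inv {J : Set (Equiv.Perm (Fin n))} {w : Equiv.Perm (Fin n)}
    (hw : ∀ x, bidx J (w x) = bidx J x) (h : DecOn J w) : DecOn J w⁻¹ := by
  have hw' : ∀ x, bidx J (w⁻¹ x) = bidx J x := fun x => by rw [← hw (w⁻¹ x)]; simp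
  intro x y hxy hb
  by_contra hcon
  rcases (not_lt.1 hcon).lt_or_eq with h1 | h1
  · have := h _ _ h1 (by rw [hw', hw', hb])
    simp only [Equiv.Perm.coe_inv, Equiv.apply_symm_apply] at this
    exact lt_asymm hxy this
  · exact hxy.ne (w⁻¹.injective h1)

/-- The parabolic subgroup is itself the double coset of `1`, so the results on maximal elements of
double cosets apply to longest elements. -/
theorem longest_eq_maxElt (J : Set (Equiv.Perm (Fin n))) :
    longest (simples n) J = maxElt (simples n) (dcoset J J 1) := by
  unfold longest
  congr 1
  ext y
  exact mem_dcoset_same.symm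

theorem longest_spec {J : Set (Equiv.Perm (Fin n))} (hJ : J ⊆ simples n) :
    (∀ x, bidx J (longest (simples n) J x) = bidx J x) ∧ DecOn J (longest (simples n) J) := by
  obtain ⟨z, hz, h1, h2, -⟩ := exists_decOn_ge hJ hJ (self_mem_dcoset J J 1)
  rw [longest_eq_maxElt, maxElt_eq hJ hJ hz h1 h2]
  exact ⟨(mem_closure_iff hJ z).1 (mem_dcoset_same.1 hz), h1⟩

theorem longest_eq {J : Set (Equiv.Perm (Fin n))} (hJ : J ⊆ simples n) {w : Equiv.Perm (Fin n)}
    (h1 : ∀ x, bidx J (w x) = bidx J x) (h2 : DecOn J w) : longest (simples n) J = w := by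
  rw [longest_eq_maxElt]
  exact maxElt_eq hJ hJ (mem_dcoset_same.2 ((mem_closure_iff hJ w).2 h1)) h2 (h2.inv h1)

/-- The longest element reverses each neighbouring pair given by `J`. If it also preserves the
blocks of `K`, monotonicity of `bidx K` puts such a pair in one block of `K`. -/
theorem longest_injective {J K : Set (Equiv.Perm (Fin n))} (hJ : J ⊆ simples n)
    (hK : K ⊆ simples n) (h : longest (simples n) J = longest (simples n) K) : J = K := by
  have key : ∀ {J K : Set (Equiv.Perm (Fin n))}, J ⊆ simples n → K ⊆ simples n →
      longest (simples n) J = longest (simples n) K → J ⊆ K := by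
    intro J K hJ hK h w hw
    obtain ⟨i, j, hij, rfl⟩ := hJ hw
    rw [mem_iff_bidx hij] at hw ⊢
    have hlt : i < j := by rw [Fin.lt_def]; omega
    have h1 := (longest_spec hJ).2 i j hlt hw
    rw [h] at h1
    have h2 := bidx_mono K h1.le
    rw [(longest_spec hK).1, (longest_spec hK).1] at h2
    exact le_antisymm (bidx_mono K hlt.le) h2
  exact (key hJ hK h).antisymm (key hK hJ h.symm)

end Extremal

/-! ### Block permutations and core cosets. -/

section BlockPerm

/-- `z` maps the components of `J` increasingly onto the components of `I`. -/
structure BlockPerm (I J : Set (Equiv.Perm (Fin n))) (z : Equiv.Perm (Fin n)) : Prop where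
  left_subset : I ⊆ simples n
  right_subset : J ⊆ simples n
  bidx_iff : ∀ x y, bidx I (z x) = bidx I (z y) ↔ bidx J x = bidx J y
  incOn : IncOn J z

variable {I J K : Set (Equiv.Perm (Fin n))} {z z' : Equiv.Perm (Fin n)}

theorem BlockPerm.inv (h : BlockPerm I J z) : BlockPerm J I z⁻¹ where
  left_subset := h.right_subset
  right_subset := h.left_subset
  bidx_iff x y := by
    rw [← h.bidx_iff]
    simp
  incOn x y hxy hb := by
    by_contra hcon
    rcases (not_lt.1 hcon).lt_or_eq with h1 | h1
    · have := h.incOn _ _ h1 (by rw [← h.bidx_iff]; simpa using hb.symm)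
      simp only [Equiv.Perm.coe_inv, Equiv.apply_symm_apply] at this
      exact lt_asymm hxy this
    · exact hxy.ne' (z⁻¹.injective h1)

theorem blockPerm_one (hI : I ⊆ simples n) : BlockPerm I I 1 :=
  ⟨hI, hI, fun _ _ => Iff.rfl, fun _ _ h _ => h⟩

theorem BlockPerm.mul (h : BlockPerm I J z) (h' : BlockPerm J K z') :
    BlockPerm I K (z * z') where
  left_subset := h.left_subset
  right_subset := h'.right_subset
  bidx_iff x y := by
    rw [Equiv.Perm.mul_apply, Equiv.Perm.mul_apply, h.bidx_iff, h'.bidx_iff]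
  incOn x y hxy hb := h.incOn _ _ (h'.incOn x y hxy hb) ((h'.bidx_iff x y).2 hb)

theorem BlockPerm.minElt_eq (h : BlockPerm I J z) :
    minElt (simples n) (dcoset I J z) = z :=
  CoreCoset.minElt_eq h.left_subset h.right_subset (self_mem_dcoset I J z) h.incOn h.inv.incOn

/-- The conjugate exchanges `z i` and `z j`, so these must be neighbours. A point strictly between
them would lie in the same block of `I`, and its preimage would lie strictly between the neighbours
`i` and `j`. -/
theorem BlockPerm.conj_mem (h : BlockPerm I J z) {s : Equiv.Perm (Fin n)} (hs : s ∈ J) :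
    z * s * z⁻¹ ∈ I := by
  obtain ⟨i, j, hij, rfl⟩ := h.right_subset hs
  rw [← Equiv.swap_apply_apply]
  have hlt : i < j := by rw [Fin.lt_def]; omega
  have hb := (mem_iff_bidx hij).1 hs
  have hz := h.incOn i j hlt hb
  have hb' := (h.bidx_iff i j).2 hb
  refine (mem_iff_bidx ?_).2 hb'
  by_contra hne
  rw [Fin.lt_def] at hz
  set k : Fin n := ⟨z i + 1, by omega⟩ with hk
  have h1 : z i < k := by rw [Fin.lt_def]; simp [hk]
  have h2 : k < z j := by rw [Fin.lt_def]; simp only [hk]; omega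
  have hbk : bidx I (z i) = bidx I k :=
    le_antisymm (bidx_mono I h1.le) (hb' ▸ bidx_mono I h2.le)
  have h3 := h.inv.incOn _ _ h1 hbk
  have h4 := h.inv.incOn _ _ h2 (hbk.symm.trans hb')
  simp only [Equiv.Perm.coe_inv, Equiv.symm_apply_apply] at h3 h4
  rw [Fin.lt_def] at h3 h4
  omega

theorem BlockPerm.conj_image (h : BlockPerm I J z) : (fun s => z * s * z⁻¹) '' J = I := by
  ext s
  constructor
  · rintro ⟨s, hs, rfl⟩
    exact h.conj_mem hs
  · intro hs
    exact ⟨z⁻¹ * s * z⁻¹⁻¹, h.inv.conj_mem hs, by group⟩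

theorem BlockPerm.ncard_eq (h : BlockPerm I J z) : I.ncard = J.ncard := by
  rw [← h.conj_image]
  refine Set.ncard_image_of_injective J fun a b hab => ?_
  simpa using hab

/-- Conjugation carries the transposition of `i` and `j` to that of `z i` and `z j`, so `h1`
transports the relation of lying in one block along `z`, and `h2` transports it back. -/
theorem blockPerm_of_conj (hI : I ⊆ simples n) (hJ : J ⊆ simples n) (hinc : IncOn J z)
    (h1 : ∀ s ∈ J, z * s * z⁻¹ ∈ I) (h2 : ∀ s ∈ I, z⁻¹ * s * z ∈ J) : BlockPerm I J z := by
  have key : ∀ {I J : Set (Equiv.Perm (Fin n))} {z : Equiv.Perm (Fin n)}, I ⊆ simples n →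
      (∀ s ∈ J, z * s * z⁻¹ ∈ I) → ∀ x y, bidx J x = bidx J y →
      bidx I (z x) = bidx I (z y) := by
    intro I J z hI h1
    have hlt : ∀ x y, x < y → bidx J x = bidx J y → bidx I (z x) = bidx I (z y) := by
      intro x y hxy hb
      refine rel_of_adjacent (R := fun a b => bidx I (z a) = bidx I (z b))
        (fun _ _ _ => Eq.trans) hxy fun i j hij hi hj => ?_
      have hs := h1 _ (swap_mem_of_between hb hij hi hj)
      rw [← Equiv.swap_apply_apply] at hs
      have := (mem_closure_iff hI _).1 (Subgroup.subset_closure hs) (z j)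
      rwa [Equiv.swap_apply_right] at this
    intro x y hb
    rcases lt_trichotomy x y with h | rfl | h
    · exact hlt x y h hb
    · rfl
    · exact (hlt y x h hb.symm).symm
  refine ⟨hI, hJ, fun x y => ⟨fun h => ?_, key hI h1 x y⟩, hinc⟩
  have := key (z := z⁻¹) hJ (by simpa using h2) _ _ h
  simpa using this

/-- Full left and right redundancy says that the minimal element conjugates `J` to `I`; minimality
supplies monotonicity on blocks. All later arguments about core cosets use the block permutation
instead. -/
theorem isCore_iff {p : Set (Equiv.Perm (Fin n))} :
    IsCore (simples n) I J p ↔ ∃ z, BlockPerm I J z ∧ p = dcoset I J z := by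
  constructor
  · rintro ⟨⟨hI, hJ, w, rfl⟩, hl, hr⟩
    obtain ⟨h1, h2, h3⟩ := minElt_spec hI hJ w
    unfold leftRed at hl
    unfold rightRed at hr
    set z := minElt (simples n) (dcoset I J w)
    refine ⟨z, blockPerm_of_conj hI hJ h2 ?_ ?_, (dcoset_eq_of_mem h1).symm⟩
    · intro s hs
      rw [← hr] at hs
      obtain ⟨⟨t, ht, rfl⟩, -⟩ := hs
      convert ht using 1
      group
    · intro s hs
      rw [← hl] at hs
      obtain ⟨-, ⟨t, ht, rfl⟩⟩ := hs
      convert ht using 1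
      group
  · rintro ⟨z, h, rfl⟩
    refine ⟨⟨h.left_subset, h.right_subset, z, rfl⟩, ?_, ?_⟩
    · rw [leftRed, h.minElt_eq, h.conj_image, Set.inter_self]
    · have := h.inv.conj_image
      rw [inv_inv] at this
      rw [rightRed, h.minElt_eq, this, Set.inter_self]

theorem BlockPerm.isCore (h : BlockPerm I J z) : IsCore (simples n) I J (dcoset I J z) :=
  isCore_iff.2 ⟨z, h, rfl⟩

theorem BlockPerm.eq_of_dcoset_eq (h : BlockPerm I J z) (h' : BlockPerm I J z')
    (he : dcoset I J z = dcoset I J z') : z = z' := by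
  rw [← h.minElt_eq, he, h'.minElt_eq]

theorem BlockPerm.isBlockPerm (h : BlockPerm I J z) : IsBlockPerm I J z := by
  intro x
  rw [component_eq, component_eq]
  constructor
  · ext y
    constructor
    · rintro ⟨a, ha, rfl⟩
      exact (h.bidx_iff _ _).2 ha
    · intro hy
      refine ⟨z⁻¹ y, (h.bidx_iff _ _).1 ?_, by simp⟩
      simpa using hy
  · intro a ha b hb hab
    exact h.incOn a b hab (Eq.trans ha (Eq.symm hb))

/-- Reversing each block of `J` and then moving blocks increasingly gives a permutation decreasing
on blocks. As it also matches the blocks of `J` with those of `I`, its inverse is decreasing on the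
latter. -/
theorem BlockPerm.maxElt_eq (h : BlockPerm I J z) :
    maxElt (simples n) (dcoset I J z) = z * longest (simples n) J := by
  obtain ⟨h1, h2⟩ := longest_spec h.right_subset
  set v := longest (simples n) J
  have hd : DecOn J (z * v) := by
    intro x y hxy hb
    exact h.incOn _ _ (h2 x y hxy hb) (by rw [h1, h1, hb])
  refine CoreCoset.maxElt_eq h.left_subset h.right_subset
    (mul_mem_dcoset (self_mem_dcoset I J z) ((mem_closure_iff h.right_subset _).2 h1)) hd ?_
  intro x y hxy hb
  by_contra hcon
  rcases (not_lt.1 hcon).lt_or_eq with h3 | h3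
  · have := hd _ _ h3 (by
      rw [← h1, ← h1 ((z * v)⁻¹ y), ← h.bidx_iff, ← Equiv.Perm.mul_apply,
        ← Equiv.Perm.mul_apply]
      simpa using hb)
    simp only [Equiv.Perm.coe_inv, Equiv.apply_symm_apply] at this
    exact lt_asymm hxy this
  · exact hxy.ne ((z * v)⁻¹.injective h3)

/-- The longest element reverses only pairs inside a block, and `z` keeps the order there. -/
theorem BlockPerm.lenAdd_longest (h : BlockPerm I J z) :
    LenAdd (simples n) z (longest (simples n) J) := by
  obtain ⟨h1, -⟩ := longest_spec h.right_subset
  rw [lenAdd_iff]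
  intro i j hij hlt
  have hb : bidx J j = bidx J i := by
    refine le_antisymm ?_ (bidx_mono J hij.le)
    rw [← h1 j, ← h1 i]
    exact bidx_mono J hlt.le
  exact h.incOn _ _ hlt (by rw [h1, h1, hb])

end BlockPerm

/-! ### The squashed permutation: existence, uniqueness, products and lifting. -/

section Squash

variable {I J K I' : Set (Equiv.Perm (Fin n))} {z z' : Equiv.Perm (Fin n)} {m : ℕ}
  {w w' : Equiv.Perm (Fin (n - m))}

theorem isSquash_iff : IsSquash m I J z w ↔
    ∀ x, ∃ c : Fin (n - m), (c : ℕ) = bidx J x ∧ (w c : ℕ) = bidx I (z x) := by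
  unfold IsSquash
  simp only [compIndex_eq]

theorem IsSquash.apply (h : IsSquash m I J z w) {x : Fin n} {c : Fin (n - m)}
    (hc : (c : ℕ) = bidx J x) : (w c : ℕ) = bidx I (z x) := by
  obtain ⟨d, hd, hw⟩ := isSquash_iff.1 h x
  obtain rfl : c = d := Fin.ext (hc.trans hd.symm)
  exact hw

theorem exists_bidx_eq_val (hJ : J ⊆ simples n) (hm : J.ncard = m) (c : Fin (n - m)) :
    ∃ x, (c : ℕ) = bidx J x := by
  obtain ⟨x, hx⟩ := (exists_bidx_eq_iff hJ c).2 (hm ▸ c.2)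
  exact ⟨x, hx.symm⟩

theorem bidx_lt (hJ : J ⊆ simples n) (hm : J.ncard = m) (x : Fin n) : bidx J x < n - m :=
  hm ▸ (exists_bidx_eq_iff hJ _).1 ⟨x, rfl⟩

theorem isSquash_of_apply (hJ : J ⊆ simples n) (hm : J.ncard = m)
    (h : ∀ x, ∀ c : Fin (n - m), (c : ℕ) = bidx J x → (w c : ℕ) = bidx I (z x)) :
    IsSquash m I J z w :=
  isSquash_iff.2 fun x => ⟨⟨_, bidx_lt hJ hm x⟩, rfl, h x _ rfl⟩

theorem IsSquash.unique (hJ : J ⊆ simples n) (hm : J.ncard = m) (h : IsSquash m I J z w)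
    (h' : IsSquash m I J z w') : w = w' := by
  ext c
  obtain ⟨x, hx⟩ := exists_bidx_eq_val hJ hm c
  rw [h.apply hx, h'.apply hx]

theorem BlockPerm.exists_isSquash (h : BlockPerm I J z) (hm : J.ncard = m) :
    ∃ w, IsSquash m I J z w := by
  choose f hf using exists_bidx_eq_val h.right_subset hm
  -- The point `f c` represents block `c`; the block of its image does not depend on this choice.
  let g : Fin (n - m) → Fin (n - m) := fun c =>
    ⟨bidx I (z (f c)), bidx_lt h.left_subset (h.ncard_eq.trans hm) _⟩
  have hg : g.Injective := by
    intro c d hcd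
    have h1 : bidx I (z (f c)) = bidx I (z (f d)) := congrArg Fin.val hcd
    rw [h.bidx_iff, ← hf, ← hf] at h1
    exact Fin.ext h1
  refine ⟨Equiv.ofBijective g (Finite.injective_iff_bijective.1 hg),
    isSquash_of_apply h.right_subset hm fun x c hc => ?_⟩
  change bidx I (z (f c)) = _
  rw [h.bidx_iff, ← hc, hf]

theorem BlockPerm.isSquash (h : BlockPerm I J z) (hm : J.ncard = m) :
    IsSquash m I J z (squash m I J z) := by
  have hex := h.exists_isSquash hm
  unfold squash
  rw [dif_pos hex]
  exact hex.choose_spec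

theorem BlockPerm.isSquash_iff (h : BlockPerm I J z) (hm : J.ncard = m) :
    IsSquash m I J z w ↔ w = squash m I J z := by
  constructor
  · intro hw
    exact hw.unique h.right_subset hm (h.isSquash hm)
  · rintro rfl
    exact h.isSquash hm

theorem BlockPerm.Sq_dcoset (h : BlockPerm I J z) : Sq m I J (dcoset I J z) = squash m I J z := by
  rw [Sq, h.minElt_eq]

theorem IsSquash.inv (hI : I ⊆ simples n) (hm : I.ncard = m) (h : IsSquash m I J z w) :
    IsSquash m J I z⁻¹ w⁻¹ := by
  refine isSquash_of_apply hI hm fun x c hc => ?_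
  obtain ⟨d, hd, hw⟩ := CoreCoset.isSquash_iff.1 h (z⁻¹ x)
  have : c = w d := by
    apply Fin.ext
    rw [hw, hc]
    simp
  rw [this]
  simpa using hd

theorem IsSquash.mul (hK : K ⊆ simples n) (hm : K.ncard = m) (h : IsSquash m I J z w)
    (h' : IsSquash m J K z' w') : IsSquash m I K (z * z') (w * w') :=
  isSquash_of_apply hK hm fun _ _ hc => h.apply (h'.apply hc)

theorem isSquash_one (hI : I ⊆ simples n) (hm : I.ncard = m) : IsSquash m I I 1 1 :=
  isSquash_of_apply hI hm fun _ _ hc => hc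

/-- Pairs within a block are never reversed by `z'`. For points in different blocks the order,
before and after each factor, is the order of the block indices, so conflicts upstairs and between
indices correspond. -/
theorem BlockPerm.lenAdd_iff (h : BlockPerm I J z) (h' : BlockPerm J K z') (hm : K.ncard = m)
    (hw : IsSquash m I J z w) (hw' : IsSquash m J K z' w') :
    LenAdd (simples n) z z' ↔ LenAdd (simples (n - m)) w w' := by
  rw [CoreCoset.lenAdd_iff, CoreCoset.lenAdd_iff]
  constructor
  · intro hz c d hcd hlt
    obtain ⟨i, hi⟩ := exists_bidx_eq_val h'.right_subset hm c
    obtain ⟨j, hj⟩ := exists_bidx_eq_val h'.right_subset hm d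
    rw [Fin.lt_def] at hcd hlt ⊢
    rw [hw'.apply hi, hw'.apply hj] at hlt
    rw [hw.apply (hw'.apply hi), hw.apply (hw'.apply hj)]
    rw [hi, hj] at hcd
    refine lt_of_le_of_ne (bidx_mono I (hz i j (lt_of_bidx_lt hcd) (lt_of_bidx_lt hlt)).le) ?_
    rw [Ne, h.bidx_iff, h'.bidx_iff]
    exact hcd.ne'
  · intro hz i j hij hlt
    obtain ⟨c, hc⟩ : ∃ c : Fin (n - m), (c : ℕ) = bidx K i :=
      ⟨⟨_, bidx_lt h'.right_subset hm i⟩, rfl⟩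
    obtain ⟨d, hd⟩ : ∃ d : Fin (n - m), (d : ℕ) = bidx K j :=
      ⟨⟨_, bidx_lt h'.right_subset hm j⟩, rfl⟩
    have hne : bidx K i ≠ bidx K j := fun he => lt_asymm hlt (h'.incOn i j hij he)
    have hne' : bidx J (z' j) ≠ bidx J (z' i) := fun he => hne ((h'.bidx_iff _ _).1 he).symm
    have := hz c d
    simp only [Fin.lt_def (n := n - m)] at this
    rw [hw'.apply hc, hw'.apply hd, hw.apply (hw'.apply hc), hw.apply (hw'.apply hd), hc, hd] at this
    exact lt_of_bidx_lt (this (lt_of_le_of_ne (bidx_mono K hij.le) hne)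
      (lt_of_le_of_ne (bidx_mono J hlt.le) hne'))

/-- A block permutation is determined by its source and its squashed permutation. -/
theorem BlockPerm.unique_left (h : BlockPerm I J z) (h' : BlockPerm I' J z') (hm : J.ncard = m)
    (hw : IsSquash m I J z w) (hw' : IsSquash m I' J z' w) : I = I' ∧ z = z' := by
  have hb : ∀ x, bidx I (z x) = bidx I' (z' x) := fun x => by
    obtain ⟨c, hc⟩ : ∃ c : Fin (n - m), (c : ℕ) = bidx J x :=
      ⟨⟨_, bidx_lt h.right_subset hm x⟩, rfl⟩
    rw [← hw.apply hc, ← hw'.apply hc]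
  -- The order of two images is decided by the common block indices `hb`, or, within a block, by the
  -- order of the original points.
  have hlt : ∀ x y, z x < z y → z' x < z' y := by
    intro x y hxy
    rcases (bidx_mono I hxy.le).lt_or_eq with h1 | h1
    · rw [hb, hb] at h1
      exact lt_of_bidx_lt h1
    · have h2 := (h.bidx_iff x y).1 h1
      rcases lt_trichotomy x y with h3 | rfl | h3
      · exact h'.incOn x y h3 h2
      · exact absurd hxy (lt_irrefl _)
      · exact absurd hxy (h.incOn y x h3 h2.symm).not_gt
  have hz : z' * z⁻¹ = 1 := eq_one_of_ascending _ fun i j hij => hlt _ _ (by simpa using hij)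
  have hz : z = z' := (mul_inv_eq_one.1 hz).symm
  refine ⟨bidx_injective h.left_subset h'.left_subset fun x => ?_, hz⟩
  have := hb (z⁻¹ x)
  rw [← hz] at this
  simpa using this

theorem BlockPerm.unique_right (h : BlockPerm J I z) (h' : BlockPerm J I' z') (hm : J.ncard = m)
    (hw : IsSquash m J I z w) (hw' : IsSquash m J I' z' w) : I = I' ∧ z = z' := by
  have := h.inv.unique_left h'.inv hm (hw.inv h.left_subset hm) (hw'.inv h.left_subset hm)
  exact ⟨this.1, inv_injective this.2⟩

/-- A stable sort builds the lift: points are ordered first by the new position of their block, then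
by their old order. The set `I` is read off from the resulting block function. -/
theorem exists_blockPerm_left (hJ : J ⊆ simples n) (hm : J.ncard = m)
    (w : Equiv.Perm (Fin (n - m))) : ∃ I z, BlockPerm I J z ∧ IsSquash m I J z w := by
  let b : Fin n → Fin (n - m) := fun x => ⟨_, bidx_lt hJ hm x⟩
  let f : Fin n → Fin (n - m) ×ₗ Fin n := fun x => toLex (w (b x), x)
  have hf : Monotone (f ∘ Tuple.sort f) := Tuple.monotone_sort f
  set z := (Tuple.sort f)⁻¹ with hz
  have hzs : Tuple.sort f = z⁻¹ := by rw [hz, inv_inv]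
  rw [hzs] at hf
  have hlt : ∀ x y, f x < f y → z x < z y := by
    intro x y hxy
    apply hf.reflect_lt
    simpa using hxy
  have hmono : Monotone fun y => (w (b (z⁻¹ y)) : ℕ) := by
    intro x y hxy
    have := hf hxy
    simp only [Function.comp_apply, f, Prod.Lex.toLex_le_toLex] at this
    rcases this with h | h
    · exact Nat.le_of_lt h
    · exact (congrArg Fin.val h.1).le
  obtain ⟨I, hI, hb⟩ := exists_bidx_eq hmono (by
    intro x c hc
    obtain ⟨a, ha⟩ := exists_bidx_eq_val hJ hm (w⁻¹ ⟨c, hc.trans_lt (w _).2⟩)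
    refine ⟨z a, ?_⟩
    have : b (z⁻¹ (z a)) = w⁻¹ ⟨c, hc.trans_lt (w _).2⟩ := Fin.ext (by rw [ha]; simp [b])
    change ((w (b (z⁻¹ (z a))) : Fin (n - m)) : ℕ) = c
    rw [this]
    simp)
  have hb' : ∀ x, bidx I (z x) = w (b x) := fun x => by rw [hb]; simp
  refine ⟨I, z, ⟨hI, hJ, fun x y => ?_, fun x y hxy he => hlt x y ?_⟩,
    isSquash_of_apply hJ hm fun x c hc => ?_⟩
  · rw [hb', hb', Fin.val_inj, w.injective.eq_iff, Fin.ext_iff]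
  · have : b x = b y := Fin.ext he
    simp only [f, this, Prod.Lex.toLex_lt_toLex]
    exact Or.inr ⟨trivial, hxy⟩
  · rw [hb']
    congr 2
    exact Fin.ext hc

theorem exists_blockPerm_right (hJ : J ⊆ simples n) (hm : J.ncard = m)
    (w : Equiv.Perm (Fin (n - m))) : ∃ I z, BlockPerm J I z ∧ IsSquash m J I z w := by
  obtain ⟨I, z, h, hw⟩ := exists_blockPerm_left hJ hm w⁻¹
  refine ⟨I, z⁻¹, h.inv, ?_⟩
  have := hw.inv h.left_subset (h.ncard_eq.trans hm)
  rwa [inv_inv] at this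

end Squash

/-! ### Atomic cosets are the core cosets with simple squash. -/

section Atomic

variable {I J K : Set (Equiv.Perm (Fin n))} {z : Equiv.Perm (Fin n)} {m : ℕ}
  {w : Equiv.Perm (Fin (n - m))}

/-- Removing a simple reflection splits a component. -/
theorem bidx_diff_singleton {i j : Fin n} (hij : (j : ℕ) = i + 1) (hs : Equiv.swap i j ∈ K)
    (x : Fin n) : bidx (K \ {Equiv.swap i j}) x = bidx K x + if i < x then 1 else 0 := by
  classical
  obtain ⟨k, hk⟩ := x
  induction k with
  | zero => simp [bidx, blockNat, Fin.lt_def]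
  | succ k ih =>
    rw [bidx_succ (i := ⟨k, by omega⟩) (j := ⟨k + 1, hk⟩) _ rfl,
      bidx_succ (i := ⟨k, by omega⟩) (j := ⟨k + 1, hk⟩) _ rfl, ih]
    by_cases h : (i : ℕ) = k
    · have hi : (⟨k, by omega⟩ : Fin n) = i := Fin.ext h.symm
      have hj : (⟨k + 1, hk⟩ : Fin n) = j := Fin.ext (by simp [hij, h])
      rw [hi, hj]
      simp [hs, Fin.lt_def, hij]
    · have hne : Equiv.swap (⟨k, by omega⟩ : Fin n) ⟨k + 1, hk⟩ ≠ Equiv.swap i j := fun he =>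
        h (congrArg Fin.val (swap_adjacent_injective rfl hij he).1).symm
      simp only [Set.mem_sdiff, Set.mem_singleton_iff, hne, not_false_eq_true, and_true,
        Fin.lt_def]
      split_ifs <;> omega

theorem bidx_longest_of_subset (hJ : J ⊆ simples n) (hK : K ⊆ simples n) (hJK : J ⊆ K)
    (x : Fin n) : bidx K (longest (simples n) J x) = bidx K x :=
  (mem_closure_iff hK _).1 (Subgroup.closure_mono hJK
    ((mem_closure_iff hJ _).2 (longest_spec hJ).1)) x

/-- For a single step both the element and the length telescope to those of `w_K`, so the length
condition follows from the equation of elements. -/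
theorem BlockPerm.isReducedExpr_iff (h : BlockPerm I J z) :
    IsReducedExpr (simples n) I J (dcoset I J z) [(K, J)] ↔
      I ⊆ K ∧ J ⊆ K ∧ K ⊆ simples n ∧ z * longest (simples n) J = longest (simples n) K := by
  unfold IsReducedExpr
  simp only [IsExpr, exprElt, exprLen, h.maxElt_eq, inv_mul_cancel_right]
  constructor
  · rintro ⟨-, ⟨h1, h2, h3, -⟩, h4, -⟩
    exact ⟨h1, h2, h3, h4⟩
  · rintro ⟨h1, h2, h3, h4⟩
    exact ⟨h.isCore.1, ⟨h1, h2, h3, h.right_subset, trivial⟩, h4, by rw [h4]; ring⟩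

/-- Both `I` and `J` arise from `K` by cutting one block in two, and `z` preserves the blocks of
`K`. The two halves `c`, `d` of the block cut by `J` must go to different blocks of `I`, so `I` cuts
the same block of `K`; hence `w` permutes `c` and `d` and fixes every other index. It cannot be
trivial. -/
theorem BlockPerm.mem_simples_of_longest (h : BlockPerm I J z) (hm : J.ncard = m)
    (hw : IsSquash m I J z w) {i j i' j' : Fin n} (hij : (j : ℕ) = i + 1)
    (hij' : (j' : ℕ) = i' + 1) (hK : K ⊆ simples n) (hs : Equiv.swap i j ∈ K)
    (ht : Equiv.swap i' j' ∈ K) (hI : I = K \ {Equiv.swap i j}) (hJ : J = K \ {Equiv.swap i' j'})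
    (hz : z * longest (simples n) J = longest (simples n) K) : w ∈ simples (n - m) := by
  have hbI : ∀ x, bidx I x = bidx K x + if i < x then 1 else 0 :=
    fun x => by rw [hI, bidx_diff_singleton hij hs]
  have hbJ : ∀ x, bidx J x = bidx K x + if i' < x then 1 else 0 :=
    fun x => by rw [hJ, bidx_diff_singleton hij' ht]
  have hJK : J ⊆ K := hJ ▸ Set.sdiff_subset
  have hzK : ∀ x, bidx K (z x) = bidx K x := by
    intro x
    have h1 := (longest_spec hK).1 ((longest (simples n) J)⁻¹ x)
    have h2 := bidx_longest_of_subset h.right_subset hK hJK ((longest (simples n) J)⁻¹ x)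
    rw [← hz] at h1
    simp only [Equiv.Perm.mul_apply, Equiv.Perm.coe_inv, Equiv.apply_symm_apply] at h1 h2
    exact h1.trans h2.symm
  have hwx : ∀ x (c : Fin (n - m)), (c : ℕ) = bidx K x + (if i' < x then 1 else 0) →
      (w c : ℕ) = bidx K x + if i < z x then 1 else 0 := by
    intro x c hc
    rw [hw.apply (hc.trans (hbJ x).symm), hbI, hzK]
  have hlt' : i' < j' := by rw [Fin.lt_def]; omega
  have hc' := (mem_iff_bidx hij').1 ht
  have hJi := hbJ i'
  have hJj := hbJ j'
  rw [if_neg (lt_irrefl _), add_zero] at hJi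
  rw [if_pos hlt', ← hc'] at hJj
  set c : Fin (n - m) := ⟨_, bidx_lt h.right_subset hm i'⟩ with hc
  set d : Fin (n - m) := ⟨_, bidx_lt h.right_subset hm j'⟩ with hd
  have hcv : (c : ℕ) = bidx K i' := hJi
  have hdv : (d : ℕ) = bidx K i' + 1 := hJj
  have hwc := hwx i' c (by simp [hcv])
  have hwd := hwx j' d (by rw [hdv, if_pos hlt', hc'])
  rw [← hc'] at hwd
  have hwcd : (w c : ℕ) ≠ w d := by
    rw [Ne, Fin.val_inj, w.injective.eq_iff, Fin.ext_iff]
    omega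
  rcases lt_trichotomy (bidx K i') (bidx K i) with hlt | heq | hlt
  · have h1 : z i' < i := lt_of_bidx_lt (J := K) (by rw [hzK]; exact hlt)
    have h2 : z j' < i := lt_of_bidx_lt (J := K) (by rw [hzK, ← hc']; exact hlt)
    rw [if_neg h1.not_gt] at hwc
    rw [if_neg h2.not_gt] at hwd
    exact absurd (hwc.trans hwd.symm) hwcd
  · have hfix : ∀ e : Fin (n - m), e ≠ c → e ≠ d → w e = e := by
      intro e hec hed
      rw [Ne, Fin.ext_iff] at hec hed
      obtain ⟨x, hx⟩ := exists_bidx_eq_val h.right_subset hm e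
      rw [hbJ] at hx
      apply Fin.ext
      rw [hwx x e hx, hx]
      rcases lt_trichotomy (bidx K x) (bidx K i') with h1 | h1 | h1
      · have h2 := lt_of_bidx_lt h1
        have h3 : z x < i := lt_of_bidx_lt (J := K) (by rw [hzK, ← heq]; exact h1)
        rw [if_neg h2.not_gt, if_neg h3.not_gt]
      · split_ifs at hx <;> omega
      · have h2 := lt_of_bidx_lt h1
        have h3 : i < z x := lt_of_bidx_lt (J := K) (by rw [hzK, ← heq]; exact h1)
        rw [if_pos h2, if_pos h3]
    by_cases h1 : i < z i'
    · rw [if_pos h1] at hwc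
      have h2 : ¬ i < z j' := by
        intro h2
        rw [if_pos h2] at hwd
        omega
      rw [if_neg h2] at hwd
      refine ⟨c, d, by omega, ?_⟩
      ext e
      rw [Equiv.swap_apply_def]
      split_ifs with h3 h4
      · rw [h3]; omega
      · rw [h4]; omega
      · rw [hfix e h3 h4]
    · exfalso
      rw [if_neg h1] at hwc
      have h2 : i < z j' := by
        by_contra h2
        rw [if_neg h2] at hwd
        omega
      rw [if_pos h2] at hwd
      -- A trivial squash would force `z = 1`, hence `w_J = w_K` and `J = K`, although a reflection
      -- of `K` was removed to obtain `J`.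
      have hw1 : w = 1 := by
        ext e
        rw [Equiv.Perm.one_apply]
        by_cases h3 : e = c
        · rw [h3]; omega
        by_cases h4 : e = d
        · rw [h4]; omega
        rw [hfix e h3 h4]
      rw [hw1] at hw
      have hmI := h.ncard_eq.trans hm
      obtain ⟨-, hz1⟩ := h.unique_right (blockPerm_one h.left_subset) hmI hw
        (isSquash_one h.left_subset hmI)
      rw [hz1, one_mul] at hz
      have hJK' := longest_injective h.right_subset hK hz
      rw [← hJK', hJ] at ht
      exact ht.2 rfl
  · have h1 : i < z i' := lt_of_bidx_lt (J := K) (by rw [hzK]; exact hlt)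
    have h2 : i < z j' := lt_of_bidx_lt (J := K) (by rw [hzK, ← hc']; exact hlt)
    rw [if_pos h1] at hwc
    rw [if_pos h2] at hwd
    exact absurd (hwc.trans hwd.symm) hwcd

theorem union_diff_of_notMem {s : Equiv.Perm (Fin n)} (hs : s ∉ I) : I = (I ∪ {s}) \ {s} := by
  ext x
  simp only [Set.mem_sdiff, Set.mem_union, Set.mem_singleton_iff]
  constructor
  · intro hx
    exact ⟨Or.inl hx, fun he => hs (he ▸ hx)⟩
  · tauto

theorem IsAtomic.exists_blockPerm {p : Set (Equiv.Perm (Fin n))}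
    (h : IsAtomic (simples n) I J p) (hm : J.ncard = m) :
    ∃ z, BlockPerm I J z ∧ p = dcoset I J z ∧ squash m I J z ∈ simples (n - m) := by
  obtain ⟨hcore, s, ⟨i, j, hij, rfl⟩, t, ⟨i', j', hij', rfl⟩, hsI, htK, hJ, hred⟩ := h
  obtain ⟨z, hz, rfl⟩ := isCore_iff.1 hcore
  obtain ⟨-, -, hK, he⟩ := hz.isReducedExpr_iff.1 hred
  exact ⟨z, hz, rfl, hz.mem_simples_of_longest hm (hz.isSquash hm) hij hij' hK (Or.inr rfl) htK
    (union_diff_of_notMem hsI) hJ he⟩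

/-- If the squash exchanges blocks `c` and `d = c + 1`, merging these two on either side gives the
same set `K`, and `z * w_J` reverses every block of `K`. -/
theorem BlockPerm.isAtomic (h : BlockPerm I J z) (hm : J.ncard = m)
    (hsq : squash m I J z ∈ simples (n - m)) : IsAtomic (simples n) I J (dcoset I J z) := by
  have hw := h.isSquash hm
  obtain ⟨c, d, hcd, he⟩ := hsq
  rw [he] at hw
  have hmI := h.ncard_eq.trans hm
  obtain ⟨x, hx⟩ := exists_bidx_eq_val h.left_subset hmI d
  obtain ⟨i, j, hij, hi, hj⟩ := exists_bidx_jump I (c := c) (x := x) (by omega)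
  obtain ⟨x', hx'⟩ := exists_bidx_eq_val h.right_subset hm d
  obtain ⟨i', j', hij', hi', hj'⟩ := exists_bidx_jump J (c := c) (x := x') (by omega)
  have hsI : Equiv.swap i j ∉ I := fun hs => by
    have := bidx_of_mem hij hs
    omega
  have htJ : Equiv.swap i' j' ∉ J := fun hs => by
    have := bidx_of_mem hij' hs
    omega
  -- the function merging the values `c` and `c + 1`
  let φ : ℕ → ℕ := fun a => if a ≤ c then a else a - 1
  have merge : ∀ {I : Set (Equiv.Perm (Fin n))} {i j : Fin n}, (j : ℕ) = i + 1 →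
      bidx I i = c → bidx I j = c + 1 → Equiv.swap i j ∉ I →
      ∀ x, bidx (I ∪ {Equiv.swap i j}) x = φ (bidx I x) := by
    intro I i j hij hi hj hs x
    have h1 := bidx_diff_singleton (K := I ∪ {Equiv.swap i j}) hij (Or.inr rfl) x
    rw [← union_diff_of_notMem hs] at h1
    simp only [φ]
    by_cases hix : i < x
    · have h2 := bidx_mono I (show j ≤ x by rw [Fin.lt_def] at hix; rw [Fin.le_def]; omega)
      rw [if_pos hix] at h1
      rw [if_neg (by omega)]
      omega
    · have h2 := bidx_mono I (not_lt.1 hix)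
      rw [if_neg hix] at h1
      rw [if_pos (by omega)]
      omega
  have hφI := merge hij hi hj hsI
  have hφJ := merge hij' hi' hj' htJ
  have hφw : ∀ e : Fin (n - m), φ (Equiv.swap c d e) = φ e := by
    intro e
    rw [Equiv.swap_apply_def]
    split_ifs with h1 h2
    · rw [h1]; simp only [φ]; split_ifs <;> omega
    · rw [h2]; simp only [φ]; split_ifs <;> omega
    · rfl
  have hKsub : I ∪ {Equiv.swap i j} ⊆ simples n :=
    Set.union_subset h.left_subset (Set.singleton_subset_iff.2 ⟨i, j, hij, rfl⟩)
  have hKsub' : J ∪ {Equiv.swap i' j'} ⊆ simples n :=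
    Set.union_subset h.right_subset (Set.singleton_subset_iff.2 ⟨i', j', hij', rfl⟩)
  have hzK : ∀ x, bidx (I ∪ {Equiv.swap i j}) (z x) = bidx (J ∪ {Equiv.swap i' j'}) x := by
    intro x
    obtain ⟨e, he⟩ : ∃ e : Fin (n - m), (e : ℕ) = bidx J x :=
      ⟨⟨_, bidx_lt h.right_subset hm x⟩, rfl⟩
    rw [hφI, hφJ, ← hw.apply he, hφw, he]
  -- Both merged block functions are monotone and `z` rearranges one into the other, so they
  -- coincide.
  have hKK : I ∪ {Equiv.swap i j} = J ∪ {Equiv.swap i' j'} := by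
    refine bidx_injective hKsub hKsub' fun x => ?_
    have hfun : bidx (I ∪ {Equiv.swap i j}) ∘ z = bidx (J ∪ {Equiv.swap i' j'}) := funext hzK
    have h1 := Tuple.unique_monotone (f := bidx (I ∪ {Equiv.swap i j})) (σ := z) (τ := 1)
      (by rw [hfun]; exact bidx_mono _) (bidx_mono _)
    rw [hfun] at h1
    exact (congrFun h1 x).symm
  have htK : Equiv.swap i' j' ∈ I ∪ {Equiv.swap i j} := hKK ▸ Or.inr rfl
  have hJK : J = (I ∪ {Equiv.swap i j}) \ {Equiv.swap i' j'} := by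
    rw [hKK]
    exact union_diff_of_notMem htJ
  have hJsub : J ⊆ I ∪ {Equiv.swap i j} := hKK ▸ Set.subset_union_left
  refine ⟨h.isCore, _, ⟨i, j, hij, rfl⟩, _, ⟨i', j', hij', rfl⟩, hsI, htK, hJK,
    h.isReducedExpr_iff.2 ⟨Set.subset_union_left, hJsub, hKsub, (longest_eq hKsub ?_ ?_).symm⟩⟩
  · intro x
    rw [Equiv.Perm.mul_apply, hzK, ← hKK, bidx_longest_of_subset h.right_subset hKsub hJsub]
  · obtain ⟨hl1, hl2⟩ := longest_spec h.right_subset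
    intro x y hxy hb
    rw [hKK, hφJ, hφJ] at hb
    rw [Equiv.Perm.mul_apply, Equiv.Perm.mul_apply]
    -- Two points of one merged block either lie in blocks `c` and `d`, which `z` exchanges, or in
    -- one block of `J`, which `w_J` reverses and `z` carries along increasingly.
    rcases (bidx_mono J hxy.le).lt_or_eq with h1 | h1
    · have h2 : bidx J x = c ∧ bidx J y = d := by
        simp only [φ] at hb
        split_ifs at hb <;> omega
      have h3 := hw.apply (x := longest (simples n) J x) (c := c) (by rw [hl1, h2.1])
      have h4 := hw.apply (x := longest (simples n) J y) (c := d) (by rw [hl1, h2.2])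
      rw [Equiv.swap_apply_left] at h3
      rw [Equiv.swap_apply_right] at h4
      exact lt_of_bidx_lt (J := I) (by omega)
    · exact h.incOn _ _ (hl2 x y hxy h1) (by rw [hl1, hl1, h1])

end Atomic

/-! ### Atomic expressions, words in simple reflections and reduced products. -/

section Expressions

variable {I J K I' : Set (Equiv.Perm (Fin n))} {z z' : Equiv.Perm (Fin n)} {m : ℕ}

theorem len_prod_le (l : List (Equiv.Perm (Fin n))) (hl : ∀ x ∈ l, x ∈ simples n) :
    len (simples n) l.prod ≤ l.length := by
  have h1 := inv2_prod_le l hl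
  have h2 := two_mul_len l.prod
  omega

theorem dcoset_longest (hI : BlockPerm I J z)
    (h : z * longest (simples n) J = longest (simples n) K) :
    dcoset I J (longest (simples n) K) = dcoset I J z := by
  rw [← h]
  exact dcoset_eq_of_mem (mul_mem_dcoset (self_mem_dcoset I J z)
    ((mem_closure_iff hI.right_subset _).2 (longest_spec hI.right_subset).1))

theorem exists_blockPerm_of_step (hm : I.ncard = m)
    (h : ∃ q, IsAtomic (simples n) I I' q ∧ IsReducedExpr (simples n) I I' q [(K, I')]) :
    ∃ z, BlockPerm I I' z ∧ I'.ncard = m ∧ K ⊆ simples n ∧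
      z * longest (simples n) I' = longest (simples n) K ∧
      squash m I I' z = Sq m I I' (dcoset I I' (longest (simples n) K)) ∧
      squash m I I' z ∈ simples (n - m) := by
  obtain ⟨q, hq, hred⟩ := h
  obtain ⟨z, hz, rfl⟩ := isCore_iff.1 hq.1
  have hm' : I'.ncard = m := hz.ncard_eq.symm.trans hm
  obtain ⟨z', hz', he, hs⟩ := hq.exists_blockPerm hm'
  obtain rfl := hz.eq_of_dcoset_eq hz' he
  obtain ⟨-, -, hK, hl⟩ := hz.isReducedExpr_iff.1 hred
  exact ⟨z, hz, hm', hK, hl, by rw [dcoset_longest hz hl, hz.Sq_dcoset], hs⟩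

/-- The element expressed by a composition of atomic expressions, its squashed permutation, and
the reducedness of both. -/
theorem exists_blockPerm_of_atomicSteps
    (l : List (Set (Equiv.Perm (Fin n)) × Set (Equiv.Perm (Fin n))))
    (hm : I.ncard = m) (hl : IsExpr (simples n) I J l) (ha : AtomicSteps (simples n) I l) :
    ∃ z, BlockPerm I J z ∧ IsSquash m I J z (sqExpr m I l).prod ∧
      exprElt (simples n) I l = z * longest (simples n) J ∧
      (∀ x ∈ sqExpr m I l, x ∈ simples (n - m)) ∧
      (len (simples n) z + len (simples n) (longest (simples n) J) : ℤ) ≤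
        exprLen (simples n) I l ∧
      (exprLen (simples n) I l =
          len (simples n) z + len (simples n) (longest (simples n) J) ↔
        (sqExpr m I l).length = len (simples (n - m)) (sqExpr m I l).prod) := by
  induction l generalizing I with
  | nil =>
    obtain ⟨hI, rfl⟩ := hl
    refine ⟨1, blockPerm_one hI, isSquash_one hI hm, by simp [exprElt], by simp [sqExpr], ?_, ?_⟩
    · simp [exprLen, len_one]
    · simp [exprLen, sqExpr, len_one]
  | cons a l ih =>
    obtain ⟨K, I'⟩ := a
    obtain ⟨-, -, -, hl⟩ := hl
    obtain ⟨hstep, ha⟩ := ha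
    obtain ⟨z₁, hz₁, hm', hK, he, hsq, hs⟩ := exists_blockPerm_of_step hm hstep
    obtain ⟨z, hz, hw, hexpr, hmem, hle, hiff⟩ := ih hm' hl ha
    have hw₁ := hz₁.isSquash hm'
    have hmJ : J.ncard = m := hz.ncard_eq.symm.trans hm'
    have hmem' : ∀ x ∈ sqExpr m I ((K, I') :: l), x ∈ simples (n - m) := by
      intro x hx
      rw [sqExpr, ← hsq] at hx
      rcases List.mem_cons.1 hx with rfl | hx
      · exact hs
      · exact hmem x hx
    refine ⟨z₁ * z, hz₁.mul hz, ?_, ?_, hmem', ?_⟩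
    · rw [sqExpr, ← hsq, List.prod_cons]
      exact hw₁.mul hz.right_subset hmJ hw
    · rw [exprElt, hexpr, ← he]
      group
    -- The first step contributes `ℓ(z₁)` to the expression length and one letter to the word.
    -- Equality on either side holds iff it holds for the tail and the product with the first factor
    -- is reduced; `h2` identifies the latter conditions.
    · have h1 := hz₁.lenAdd_longest
      have h2 := hz₁.lenAdd_iff hz hmJ hw₁ hw
      have h3 := len_mul_le z₁ z
      have h4 := len_of_mem_simples hs
      have h5 := len_prod_le _ hmem
      have h6 := len_mul_le (squash m I I' z₁) (sqExpr m I' l).prod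
      rw [LenAdd, he] at h1
      unfold LenAdd at h2
      rw [exprLen, sqExpr, ← hsq, List.prod_cons, List.length_cons]
      omega

/-- The current set and the next letter determine the next set and `z`; then `w_K = z * w_{I'}`
determines `K`. -/
theorem sqExpr_injective {l l' : List (Set (Equiv.Perm (Fin n)) × Set (Equiv.Perm (Fin n)))}
    (hm : I.ncard = m) (h : AtomicSteps (simples n) I l) (h' : AtomicSteps (simples n) I l')
    (he : sqExpr m I l = sqExpr m I l') : l = l' := by
  induction l generalizing I l' with
  | nil =>
    cases l' with
    | nil => rfl
    | cons a l' => simp [sqExpr] at he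
  | cons a l ih =>
    cases l' with
    | nil => simp [sqExpr] at he
    | cons a' l' =>
      obtain ⟨K, I₁⟩ := a
      obtain ⟨K', I₁'⟩ := a'
      obtain ⟨z, hz, hm₁, hK, hl, hsq, -⟩ := exists_blockPerm_of_step hm h.1
      obtain ⟨z', hz', hm₁', hK', hl', hsq', -⟩ := exists_blockPerm_of_step hm h'.1
      rw [sqExpr, sqExpr, ← hsq, ← hsq'] at he
      obtain ⟨he₁, he₂⟩ := List.cons.inj he
      obtain ⟨rfl, rfl⟩ := hz.unique_right hz' hm (hz.isSquash hm₁) (he₁ ▸ hz'.isSquash hm₁')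
      obtain rfl := longest_injective hK hK' (hl.symm.trans hl')
      rw [ih hm₁ h.2 h'.2 he₂]

theorem exists_atomicSteps (ws : List (Equiv.Perm (Fin (n - m))))
    (hws : ∀ x ∈ ws, x ∈ simples (n - m)) (hI : I ⊆ simples n) (hm : I.ncard = m) :
    ∃ J l, IsExpr (simples n) I J l ∧ AtomicSteps (simples n) I l ∧ sqExpr m I l = ws := by
  induction ws generalizing I with
  | nil => exact ⟨I, [], ⟨hI, rfl⟩, trivial, rfl⟩
  | cons w ws ih =>
    obtain ⟨I', z, hz, hw⟩ := exists_blockPerm_right hI hm w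
    have hm' : I'.ncard = m := hz.ncard_eq.symm.trans hm
    have hsq := (hz.isSquash_iff hm').1 hw
    have hat := hz.isAtomic hm' (hsq ▸ hws w (by simp))
    obtain ⟨-, s, -, t, -, -, -, -, hred⟩ := id hat
    obtain ⟨hIK, hIK', hK, hl⟩ := hz.isReducedExpr_iff.1 hred
    obtain ⟨J, l, h1, h2, h3⟩ := ih (fun x hx => hws x (by simp [hx])) hz.right_subset hm'
    refine ⟨J, (I ∪ {s}, I') :: l, ⟨hIK, hIK', hK, h1⟩, ⟨⟨_, hat, hred⟩, h2⟩, ?_⟩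
    rw [sqExpr, h3, dcoset_longest hz hl, hz.Sq_dcoset, ← hsq]

theorem BlockPerm.bijOn_sqExpr (h : BlockPerm I J z) (hm : J.ncard = m) :
    Set.BijOn (sqExpr m I) {l | IsAtomicRex (simples n) I J (dcoset I J z) l}
      {l | IsRex (simples (n - m)) (squash m I J z) l} := by
  have hmI := h.ncard_eq.trans hm
  have hlen := h.lenAdd_longest
  unfold LenAdd at hlen
  refine ⟨?_, ?_, ?_⟩
  · rintro l ⟨⟨-, hl, he, hn⟩, ha⟩
    obtain ⟨z', hz', hw, he', hmem, -, hiff⟩ := exists_blockPerm_of_atomicSteps l hmI hl ha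
    rw [h.maxElt_eq] at he hn
    obtain rfl := mul_right_cancel (he.trans he')
    have hsq := (h.isSquash_iff hm).1 hw
    refine ⟨hmem, hsq, ?_⟩
    rw [← hsq]
    exact hiff.1 (by rw [← hn, hlen]; push_cast; rfl)
  · rintro l hl l' hl' he
    exact sqExpr_injective hmI hl.2 hl'.2 he
  · rintro ws ⟨hws, hprod, hn⟩
    obtain ⟨J', l, hl, ha, rfl⟩ := exists_atomicSteps ws hws h.left_subset hmI
    obtain ⟨z', hz', hw, he', -, -, hiff⟩ := exists_blockPerm_of_atomicSteps l hmI hl ha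
    rw [hprod] at hw
    -- The lift of the word ends at some set `J'`; equality of the squashes forces it to be `J` and
    -- the expressed element to be `z`.
    obtain ⟨rfl, rfl⟩ := h.unique_right hz' hmI (h.isSquash hm) hw
    refine ⟨l, ⟨⟨h.isCore.1, hl, ?_, ?_⟩, ha⟩, rfl⟩
    · rw [h.maxElt_eq, he']
    · rw [h.maxElt_eq, hlen, hiff.2 (by rw [hn, hprod])]
      push_cast
      rfl

theorem bijOn_atomic (hJ : J ⊆ simples n) (hm : J.ncard = m) :
    Set.BijOn
      (fun a : Set (Equiv.Perm (Fin n)) × Set (Equiv.Perm (Fin n)) => Sq m a.1 J a.2)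
      {a | IsAtomic (simples n) a.1 J a.2} (simples (n - m)) := by
  refine ⟨?_, ?_, ?_⟩
  · rintro ⟨I, p⟩ hp
    change IsAtomic (simples n) I J p at hp
    obtain ⟨z, hz, rfl, hs⟩ := IsAtomic.exists_blockPerm hp hm
    change Sq m I J (dcoset I J z) ∈ _
    rwa [hz.Sq_dcoset]
  · rintro ⟨I, p⟩ hp ⟨I', p'⟩ hp' he
    change IsAtomic (simples n) I J p at hp
    change IsAtomic (simples n) I' J p' at hp'
    obtain ⟨z, hz, rfl, -⟩ := IsAtomic.exists_blockPerm hp hm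
    obtain ⟨z', hz', rfl, -⟩ := IsAtomic.exists_blockPerm hp' hm
    replace he : Sq m I J (dcoset I J z) = Sq m I' J (dcoset I' J z') := he
    rw [hz.Sq_dcoset, hz'.Sq_dcoset] at he
    obtain ⟨rfl, rfl⟩ := hz.unique_left hz' hm (hz.isSquash hm) (he ▸ hz'.isSquash hm)
    rfl
  · intro w hw
    obtain ⟨I, z, hz, hsq⟩ := exists_blockPerm_left hJ hm w
    have he := (hz.isSquash_iff hm).1 hsq
    exact ⟨(I, dcoset I J z), hz.isAtomic hm (he ▸ hw), by
      change Sq m I J (dcoset I J z) = w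
      rw [hz.Sq_dcoset, he]⟩

/-- The first length condition says that `z` and `z' * w_K` multiply reducedly. Splitting `ℓ(w_K)`
off both `z * z' * w_K` and `z' * w_K` leaves additivity for `z` and `z'`. -/
theorem BlockPerm.isReducedProd (h : BlockPerm I J z) (h' : BlockPerm J K z')
    {r : Set (Equiv.Perm (Fin n))}
    (hr : IsReducedProd (simples n) I J K r (dcoset I J z) (dcoset J K z')) :
    LenAdd (simples n) z z' ∧ r = dcoset I K (z * z') := by
  obtain ⟨⟨h1, -, h3⟩, rfl⟩ := hr
  have h4 := (h.mul h').lenAdd_longest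
  have h5 := h'.lenAdd_longest
  have h6 := len_mul_le z z'
  rw [h3]
  rw [h.maxElt_eq, h'.maxElt_eq, mul_inv_cancel_right, ← mul_assoc] at *
  unfold LenAdd at *
  rw [← mul_assoc] at h1
  exact ⟨by omega, dcoset_eq_of_mem (mul_mem_dcoset (self_mem_dcoset I K (z * z'))
    ((mem_closure_iff h'.right_subset _).2 (longest_spec h'.right_subset).1))⟩

end Expressions

end CoreCoset

/-! ### Assembly of the statements on core cosets. -/

theorem mainTheorem4 (n m : ℕ) :
    -- a core coset has a well-defined squashed permutation
    (∀ I J p : Set (Equiv.Perm (Fin n)), J.ncard = m → CoreCoset.IsCore (CoreCoset.simples n) I J p →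
      I.ncard = m ∧
      CoreCoset.IsBlockPerm I J (CoreCoset.minElt (CoreCoset.simples n) p) ∧
      ∀ w : Equiv.Perm (Fin (n - m)),
        CoreCoset.IsSquash m I J (CoreCoset.minElt (CoreCoset.simples n) p) w ↔
          w = CoreCoset.Sq m I J p) ∧
    -- squashing is a bijection from atomic reduced expressions to ordinary reduced expressions
    (∀ I J p : Set (Equiv.Perm (Fin n)), J.ncard = m → CoreCoset.IsCore (CoreCoset.simples n) I J p →
      Set.BijOn (CoreCoset.sqExpr m I)
        {l | CoreCoset.IsAtomicRex (CoreCoset.simples n) I J p l}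
        {l | CoreCoset.IsRex (CoreCoset.simples (n - m)) (CoreCoset.Sq m I J p) l}) ∧
    -- atomic cosets are sent to simple reflections
    (∀ I J p : Set (Equiv.Perm (Fin n)), J.ncard = m →
      CoreCoset.IsAtomic (CoreCoset.simples n) I J p →
      CoreCoset.Sq m I J p ∈ CoreCoset.simples (n - m)) ∧
    -- for fixed `J`, this is a bijection from atomic `(I,J)`-cosets, `I` varying
    (∀ J : Set (Equiv.Perm (Fin n)), J ⊆ CoreCoset.simples n → J.ncard = m →
      Set.BijOn
        (fun a : Set (Equiv.Perm (Fin n)) × Set (Equiv.Perm (Fin n)) =>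
          CoreCoset.Sq m a.1 J a.2)
        {a | CoreCoset.IsAtomic (CoreCoset.simples n) a.1 J a.2}
        (CoreCoset.simples (n - m))) ∧
    -- reduced compositions of core cosets are sent to reduced products
    (∀ I J K r p q : Set (Equiv.Perm (Fin n)), J.ncard = m →
      CoreCoset.IsCore (CoreCoset.simples n) I J p →
      CoreCoset.IsCore (CoreCoset.simples n) J K q →
      CoreCoset.IsReducedProd (CoreCoset.simples n) I J K r p q →
      CoreCoset.IsCore (CoreCoset.simples n) I K r ∧
      CoreCoset.Sq m I K r = CoreCoset.Sq m I J p * CoreCoset.Sq m J K q ∧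
      CoreCoset.LenAdd (CoreCoset.simples (n - m))
        (CoreCoset.Sq m I J p) (CoreCoset.Sq m J K q)) := by
  refine ⟨?_, ?_, ?_, fun J hJ hm => CoreCoset.bijOn_atomic hJ hm, ?_⟩
  · intro I J p hm hp
    obtain ⟨z, hz, rfl⟩ := CoreCoset.isCore_iff.1 hp
    rw [hz.minElt_eq, hz.Sq_dcoset]
    exact ⟨hz.ncard_eq.trans hm, hz.isBlockPerm, fun w => hz.isSquash_iff hm⟩
  · intro I J p hm hp
    obtain ⟨z, hz, rfl⟩ := CoreCoset.isCore_iff.1 hp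
    rw [hz.Sq_dcoset]
    exact hz.bijOn_sqExpr hm
  · intro I J p hm hp
    obtain ⟨z, hz, rfl, hs⟩ := hp.exists_blockPerm hm
    rwa [hz.Sq_dcoset]
  · intro I J K r p q hm hp hq hr
    obtain ⟨z, hz, rfl⟩ := CoreCoset.isCore_iff.1 hp
    obtain ⟨z', hz', rfl⟩ := CoreCoset.isCore_iff.1 hq
    obtain ⟨hadd, rfl⟩ := hz.isReducedProd hz' hr
    have hmK := hz'.ncard_eq.symm.trans hm
    have hw := hz.isSquash hm
    have hw' := hz'.isSquash hmK
    rw [(hz.mul hz').Sq_dcoset, hz.Sq_dcoset, hz'.Sq_dcoset]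
    exact ⟨(hz.mul hz').isCore,
      (((hz.mul hz').isSquash_iff hmK).1 (hw.mul hz'.right_subset hmK hw')).symm,
      (hz.lenAdd_iff hz' hmK hw hw').1 hadd⟩
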